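/- Let $\mathcal X,\mathcal S,\mathcal Y,\mathcal Y_1$ be finite nonempty alphabets, let $W(y,y_1|x,s)$ be the transition law of a state-dependent discrete memoryless primitive relay channel with a noiseless relay-to-receiver link of rate $C_1\ge 0$, and let $\mathcal Q$ be a nonempty set of pmfs on $\mathcal S$ (not necessarily finite, closed or convex). In the compound primitive relay channel with family $\mathcal Q$, the state sequence $S^n$ is i.i.d. with an unknown pmf $q\in\mathcal Q$. A $(2^{nR},n)$ code consists of an encoder $f:[1:2^{nR}]\to\mathcal X^n$, a relaying function $f_1:\mathcal Y_1^n\to[1:2^{nC_1}]$ and a decoder $g:\mathcal Y^n\times[1:2^{nC_1}]\to[1:2^{nR}]$ (where $2^{nR}$ and $2^{nC_1}$ are not integers, read $\lceil 2^{nR}\rceil$ messages and $\lfloor 2^{nC_1}\rfloor$ link indices). Its error probability under $q$ is $$P_e(q,\mathscr C)=\sum_{s^n}\prod_{i=1}^n q(s_i)\;\frac1{2^{nR}}\sum_{m}\;\sum_{(y^n,y_1^n):\,g(y^n,f_1(y_1^n))\ne m}\;\prod_{i=1}^n W(y_i,y_{1,i}|x_i(m),s_i),\qquad (x_1(m),\dots,x_n(m))=f(m).$$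 It is a $(2^{nR},n,\varepsilon)$ code if $P_e(q,\mathscr C)\le\varepsilon$ for all $q\in\mathcal Q$. A $(2^{nR},n,\varepsilon)$ random code is a collection $\{\mathscr C_\gamma\}_{\gamma\in\Gamma}$ of $(2^{nR},n)$ codes with a pmf $\mu$ on $\Gamma$ such that $\sum_\gamma\mu(\gamma)P_e(q,\mathscr C_\gamma)\le\varepsilon$ for all $q\in\mathcal Q$. A rate $R$ is achievable with deterministic (random) codes if for every $\varepsilon>0$ and all sufficiently large $n$ there is a $(2^{nR},n,\varepsilon)$ deterministic (random) code; the capacity $\mathbb C(\mathcal Q)$ and the random code capacity $\mathbb C^\star(\mathcal Q)$ are the suprema of the respective achievable rates. With mutual informations in bits, $S\sim q$ independent of $(U,X)$, $(Y,Y_1)$ drawn from $W(\cdot|X,S)$, and $U$ affecting the outputs only through $X$, let $$R_{CS}(\mathcal Q)=\inf_{q\in\mathcal Q}\max_{p(x)}\min\{I_q(X;Y)+C_1,\;I_q(X;Y,Y_1)\},$$ $$R_{DF}(\mathcal Q)=\sup_{p(u,x)}\min\Big\{\inf_{q\in\mathcal Q}I_q(U;Y)+\inf_{q\in\mathcal Q}I_q(X;Y|U)+C_1,\;\inf_{q\in\mathcal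 Q}I_q(U;Y_1)+\inf_{q\in\mathcal Q}I_q(X;Y|U)\Big\},$$ the last supremum being over all pmfs on $\mathcal U\times\mathcal X$ with $\mathcal U$ an arbitrary finite set. Then $$\mathbb C(\mathcal Q)\ge R_{DF}(\mathcal Q),\qquad \mathbb C^\star(\mathcal Q)\le R_{CS}(\mathcal Q).$$ Moreover, for every $R<R_{DF}(\mathcal Q)$ there is $a>0$ such that for all sufficiently large $n$ there exists a $(2^{nR},n,e^{-an})$ deterministic code for the compound primitive relay channel with family $\mathcal Q$. -/

import Mathlib

noncomputable section

/-! ### Information measures (base 2) of random variables on a finite probability space -/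

open Classical in
/-- The pmf of the random variable `f` when the underlying outcome has pmf `p`. -/
def law {A B : Type*} [Fintype A] (p : A → ℝ) (f : A → B) (b : B) : ℝ :=
  ∑ a, if f a = b then p a else 0

/-- Mutual information `I(f; g)` in bits, for random variables `f`, `g` on the finite probability
space `(A, p)`. Terms of probability zero vanish. -/
def mutualInfo {A B C : Type*} [Fintype A] [Fintype B] [Fintype C]
    (p : A → ℝ) (f : A → B) (g : A → C) : ℝ :=
  ∑ b, ∑ c, law p (fun a => (f a, g a)) (b, c) *
    Real.logb 2 (law p (fun a => (f a, g a)) (b, c) / (law p f b * law p g c))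

/-- Conditional mutual information `I(f; g | h)` in bits. -/
def condMutualInfo {A B C D : Type*} [Fintype A] [Fintype B] [Fintype C] [Fintype D]
    (p : A → ℝ) (f : A → B) (g : A → C) (h : A → D) : ℝ :=
  ∑ b, ∑ c, ∑ d, law p (fun a => (f a, g a, h a)) (b, c, d) *
    Real.logb 2 ((law p (fun a => (f a, g a, h a)) (b, c, d) * law p h d) /
      (law p (fun a => (f a, h a)) (b, d) * law p (fun a => (g a, h a)) (c, d)))

/-! ### The channel -/

/-- A state-dependent discrete memoryless primitive relay channel with input alphabet `X`, state
alphabet `S`, output alphabet `Y` and relay input alphabet `Y₁`: a conditional pmf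
`W (y, y₁ | x, s)`, together with the rate `C₁ ≥ 0` of the noiseless relay-receiver link. -/
structure PrimitiveRelayChannel (X S Y Y₁ : Type*) [Fintype Y] [Fintype Y₁] where
  W : X → S → Y × Y₁ → ℝ
  W_mem : ∀ x s, W x s ∈ stdSimplex ℝ (Y × Y₁)
  C₁ : ℝ
  C₁_nonneg : 0 ≤ C₁

/-! ### Codes -/

/-- A deterministic code of blocklength `n` with `M` messages and `L` relay indices. -/
structure RelayCode (X Y Y₁ : Type*) (n M L : ℕ) where
  enc : Fin M → Fin n → X
  relay : (Fin n → Y₁) → Fin L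
  dec : (Fin n → Y) → Fin L → Fin M

/-- A random code: a collection of deterministic codes indexed by `Γ`, with a pmf `μ` on `Γ`. -/
structure RandomRelayCode (X Y Y₁ : Type*) (n M L : ℕ) where
  Γ : Type
  μ : PMF Γ
  code : Γ → RelayCode X Y Y₁ n M L

/-- Number of messages of a code of rate `R` and blocklength `n`; equal to `2 ^ (n R)` whenever the
latter is an integer. -/
def numMessages (n : ℕ) (R : ℝ) : ℕ := ⌈(2 : ℝ) ^ ((n : ℝ) * R)⌉₊

/-- Number of indices that a link of rate `C₁` carries in `n` channel uses; equal to `2 ^ (n C₁)`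
whenever the latter is an integer. -/
def numIndices (n : ℕ) (C₁ : ℝ) : ℕ := ⌊(2 : ℝ) ^ ((n : ℝ) * C₁)⌋₊

namespace PrimitiveRelayChannel

variable {X S Y Y₁ : Type*} [Fintype X] [Fintype S] [Fintype Y] [Fintype Y₁]

/-- The conditional probability of error of a code given the state sequence `s`, averaged over
uniformly distributed messages. -/
def errGiven (ch : PrimitiveRelayChannel X S Y Y₁) {n M L : ℕ} (c : RelayCode X Y Y₁ n M L)
    (s : Fin n → S) : ℝ :=
  (1 / (M : ℝ)) * ∑ m : Fin M, ∑ y : Fin n → Y, ∑ y₁ : Fin n → Y₁,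
    if c.dec y (c.relay y₁) ≠ m then ∏ i, ch.W (c.enc m i) (s i) (y i, y₁ i) else 0

/-- The probability of error of a code when the states are i.i.d. with pmf `q`. -/
def err (ch : PrimitiveRelayChannel X S Y Y₁) (q : S → ℝ) {n M L : ℕ}
    (c : RelayCode X Y Y₁ n M L) : ℝ :=
  ∑ s : Fin n → S, (∏ i, q (s i)) * ch.errGiven c s

/-- The probability of error of a random code when the states are i.i.d. with pmf `q`. -/
def randomErr (ch : PrimitiveRelayChannel X S Y Y₁) (q : S → ℝ) {n M L : ℕ}
    (c : RandomRelayCode X Y Y₁ n M L) : ℝ :=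
  ∑' γ, (c.μ γ).toReal * ch.err q (c.code γ)

/-- There is a `(2 ^ (n R), n, ε)` deterministic code for the compound primitive relay channel with
family of state distributions `Q`. -/
def HasCode (ch : PrimitiveRelayChannel X S Y Y₁) (Q : Set (S → ℝ)) (R : ℝ) (n : ℕ) (ε : ℝ) :
    Prop :=
  ∃ c : RelayCode X Y Y₁ n (numMessages n R) (numIndices n ch.C₁), ∀ q ∈ Q, ch.err q c ≤ ε

/-- There is a `(2 ^ (n R), n, ε)` random code for the compound primitive relay channel. -/
def HasRandomCode (ch : PrimitiveRelayChannel X S Y Y₁) (Q : Set (S → ℝ)) (R : ℝ) (n : ℕ) (ε : ℝ) :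
    Prop :=
  ∃ c : RandomRelayCode X Y Y₁ n (numMessages n R) (numIndices n ch.C₁),
    ∀ q ∈ Q, ch.randomErr q c ≤ ε

/-- `R` is achievable with deterministic codes over the compound channel. -/
def Achievable (ch : PrimitiveRelayChannel X S Y Y₁) (Q : Set (S → ℝ)) (R : ℝ) : Prop :=
  ∀ ε : ℝ, 0 < ε → ∃ N : ℕ, ∀ n ≥ N, ch.HasCode Q R n ε

/-- `R` is achievable with random codes over the compound channel. -/
def RandomAchievable (ch : PrimitiveRelayChannel X S Y Y₁) (Q : Set (S → ℝ)) (R : ℝ) : Prop :=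
  ∀ ε : ℝ, 0 < ε → ∃ N : ℕ, ∀ n ≥ N, ch.HasRandomCode Q R n ε

/-- The deterministic code capacity: the supremum, in the extended reals, of achievable rates. -/
def capacity (ch : PrimitiveRelayChannel X S Y Y₁) (Q : Set (S → ℝ)) : EReal :=
  sSup ((fun R : ℝ => (R : EReal)) '' {R | ch.Achievable Q R})

/-- The random code capacity. -/
def randomCapacity (ch : PrimitiveRelayChannel X S Y Y₁) (Q : Set (S → ℝ)) : EReal :=
  sSup ((fun R : ℝ => (R : EReal)) '' {R | ch.RandomAchievable Q R})

/-! ### The single-letter bounds -/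

/-- The joint pmf of `((U, X), (Y, Y₁))` for `(U, X) ∼ p`, an independent state `∼ q`, and outputs
drawn from the channel given the input and the state. -/
def joint (ch : PrimitiveRelayChannel X S Y Y₁) (q : S → ℝ) {U : Type*} (p : U × X → ℝ) :
    (U × X) × (Y × Y₁) → ℝ :=
  fun a => p a.1 * ∑ s, q s * ch.W a.1.2 s a.2

/-- The joint pmf of `(X, (Y, Y₁))` for `X ∼ p` and an independent state `∼ q`. -/
def jointX (ch : PrimitiveRelayChannel X S Y Y₁) (q : S → ℝ) (p : X → ℝ) : X × (Y × Y₁) → ℝ :=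
  fun a => p a.1 * ∑ s, q s * ch.W a.1 s a.2

/-- The cutset rate
`inf_{q ∈ Q} max_{p(x)} min {I_q(X; Y) + C₁, I_q(X; Y, Y₁)}`. -/
def rateCS (ch : PrimitiveRelayChannel X S Y Y₁) (Q : Set (S → ℝ)) : ℝ :=
  ⨅ q : Q, ⨆ p : stdSimplex ℝ X,
    min (mutualInfo (ch.jointX q p) (fun a => a.1) (fun a => a.2.1) + ch.C₁)
      (mutualInfo (ch.jointX q p) (fun a => a.1) (fun a => a.2))

/-- The expression under the maximum in the partial decode-forward rate, for `(U, X) ∼ p`. -/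
def valueDF (ch : PrimitiveRelayChannel X S Y Y₁) (Q : Set (S → ℝ)) {U : Type*} [Fintype U]
    (p : U × X → ℝ) : ℝ :=
  min
    ((⨅ q : Q, mutualInfo (ch.joint q p) (fun a => a.1.1) (fun a => a.2.1)) +
      (⨅ q : Q, condMutualInfo (ch.joint q p) (fun a => a.1.2) (fun a => a.2.1) (fun a => a.1.1)) +
      ch.C₁)
    ((⨅ q : Q, mutualInfo (ch.joint q p) (fun a => a.1.1) (fun a => a.2.2)) +
      (⨅ q : Q, condMutualInfo (ch.joint q p) (fun a => a.1.2) (fun a => a.2.1) (fun a => a.1.1)))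

/-- The partial decode-forward rate: the supremum over all pmfs `p(u, x)` with an auxiliary variable
`U` of arbitrary finite cardinality. -/
def rateDF (ch : PrimitiveRelayChannel X S Y Y₁) (Q : Set (S → ℝ)) : ℝ :=
  sSup {r : ℝ | ∃ (k : ℕ) (p : Fin k × X → ℝ), p ∈ stdSimplex ℝ (Fin k × X) ∧ r = ch.valueDF Q p}

end PrimitiveRelayChannel

end

/-!
**Converse.** For a fixed `q` the state can be averaged out, which leaves a memoryless channel, and
some member of a random code is at least as good as the random code. `mul_log_le_of_list_decoding`
is Fano's inequality for list decoding, with an arbitrary memoryless reference law for the outputs.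
If the reference is the output law of the codebook's own empirical letter distribution, then the
divergence on the right is exactly `n` times a single-letter mutual information
(`mul_log_le_mutualInfo`). The receiver's output alone determines a list of at most `2 ^ (n C₁)`
messages, one for each link index, and both outputs together determine a single message. These two
lists give the two terms of the cutset minimum at the same input distribution.

**Achievability.** The codes use partial decode-forward with superposition coding and binning. The
relay decodes the word over `U` from `Y₁` and forwards its bin; the receiver decodes that word
within the bin, and then the satellite word. Generating the satellite words as sequences of maps
`U → X`, drawn independently of the words over `U`, reduces the ensemble to two independent
codebooks with independent words. The bins can be fixed residue classes, because any two distinct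
words are independent.

**Arbitrary families `Q`.** The probability of a state sequence under `q` depends on the sequence
only through its type, so for each `n` some `(n + 1) ^ |S|` members of `Q` dominate all of `Q` up to
a factor two (`exists_dominating_family`). This is used twice. A decoder that accepts when one of
the dominating members has a large likelihood ratio works for all `q ∈ Q`, with exponents that are
uniform because the information densities have uniformly bounded weighted second moments
(`exists_universal_test`, `second_moment_le`). And a codebook that is good on average over the
dominating members is good for all `q ∈ Q` (`exists_forall_err_le`). No topological property of `Q`
plays a role.
-/

/-! ### Sums against product weights -/

section ProductWeights

variable {ι A : Type*} [Fintype ι] [DecidableEq ι] [Fintype A]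

lemma sum_prod_eq_prod_sum {B : ι → Type*} [∀ i, Fintype (B i)] (w : ∀ i, B i → ℝ) :
    ∑ c : ∀ i, B i, ∏ i, w i (c i) = ∏ i, ∑ a, w i a := by
  rw [Finset.prod_univ_sum, Fintype.piFinset_univ]

lemma sum_prod_eq_one {w : ι → A → ℝ} (hw : ∀ i, ∑ a, w i a = 1) :
    ∑ c : ι → A, ∏ i, w i (c i) = 1 := by
  rw [sum_prod_eq_prod_sum]
  exact Finset.prod_eq_one fun i _ => hw i

/-- The marginal of a product pmf on one coordinate. -/
lemma sum_prod_mul_apply {w : ι → A → ℝ} (hw : ∀ i, ∑ a, w i a = 1) (i : ι) (G : A → ℝ) :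
    ∑ c : ι → A, (∏ j, w j (c j)) * G (c i) = ∑ a, w i a * G a := by
  have h : ∀ c : ι → A, (∏ j, w j (c j)) * G (c i)
      = ∏ j, (w j (c j) * if j = i then G (c j) else 1) := by
    intro c
    rw [Finset.prod_mul_distrib, Finset.prod_ite_eq' Finset.univ i fun j => G (c j)]
    simp
  simp_rw [h]
  rw [sum_prod_eq_prod_sum (fun j a => w j a * if j = i then G a else 1),
    Finset.prod_eq_single i]
  · simp
  · intro j _ hj
    simp [hj, hw]
  · simp

/-- The marginal of a product pmf on two distinct coordinates. -/
lemma sum_prod_mul_apply₂ {w : A → ℝ} (hw : ∑ a, w a = 1) {i j : ι} (hij : i ≠ j)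
    (G : A → A → ℝ) :
    ∑ c : ι → A, (∏ k, w (c k)) * G (c i) (c j) = ∑ a, w a * ∑ b, w b * G a b := by
  have key : ∑ c : ι → A, (∏ k, w (c k)) * G (c i) (c j)
      = ∑ x : A × ({k // k ≠ j} → A), (w x.1 * ∏ k, w (x.2 k)) * G (x.2 ⟨i, hij⟩) x.1 := by
    refine Fintype.sum_equiv (Equiv.funSplitAt j A) _ _ fun c => ?_
    simp only [Equiv.funSplitAt_apply]
    congr 1
    rw [← Finset.mul_prod_erase Finset.univ (fun k => w (c k)) (Finset.mem_univ j)]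
    congr 1
    rw [← Finset.prod_subtype (Finset.univ.erase j) (by simp) (fun k => w (c k))]
  rw [key, Fintype.sum_prod_type]
  have h2 : ∀ b, ∑ r : {k // k ≠ j} → A, (w b * ∏ k, w (r k)) * G (r ⟨i, hij⟩) b
      = w b * ∑ a, w a * G a b := by
    intro b
    rw [← sum_prod_mul_apply (w := fun _ : {k // k ≠ j} => w) (fun _ => hw) ⟨i, hij⟩
      (fun a => G a b), Finset.mul_sum]
    exact Finset.sum_congr rfl fun r _ => by ring
  simp only [h2, Finset.mul_sum]
  rw [Finset.sum_comm]
  exact Finset.sum_congr rfl fun a _ => Finset.sum_congr rfl fun b _ => by ring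

/-- Some point is at most the average. -/
lemma exists_le_of_sum_mul_le {w F : A → ℝ} (hw0 : ∀ a, 0 ≤ w a) (hw1 : ∑ a, w a = 1) {β : ℝ}
    (h : ∑ a, w a * F a ≤ β) : ∃ a, F a ≤ β := by
  by_contra! hc
  have h1 : ∑ a, w a * (F a - β) ≤ 0 := by
    simp only [mul_sub, Finset.sum_sub_distrib, ← Finset.sum_mul, hw1]
    linarith
  have h2 : ∀ a ∈ Finset.univ, 0 ≤ w a * (F a - β) := fun a _ =>
    mul_nonneg (hw0 a) (by linarith [hc a])
  have h3 := (Finset.sum_eq_zero_iff_of_nonneg h2).1 (le_antisymm h1 (Finset.sum_nonneg h2))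
  have h4 : ∀ a, w a = 0 := fun a => by
    rcases mul_eq_zero.1 (h3 a (Finset.mem_univ a)) with h | h
    · exact h
    · linarith [hc a]
  simp [h4] at hw1

end ProductWeights

/-! ### Laws of random variables and information measures -/

section Law

variable {A B C D : Type*} [Fintype A]

lemma law_nonneg {p : A → ℝ} (hp : ∀ a, 0 ≤ p a) (f : A → B) (b : B) : 0 ≤ law p f b := by
  classical
  exact Finset.sum_nonneg fun a _ => by split_ifs <;> simp [hp]

lemma sum_law_mul [Fintype B] (p : A → ℝ) (f : A → B) (G : B → ℝ) :
    ∑ b, law p f b * G b = ∑ a, p a * G (f a) := by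
  classical
  simp only [law, Finset.sum_mul]
  rw [Finset.sum_comm]
  refine Finset.sum_congr rfl fun a _ => ?_
  simp [ite_mul]

lemma sum_law [Fintype B] (p : A → ℝ) (f : A → B) : ∑ b, law p f b = ∑ a, p a := by
  simpa using sum_law_mul p f fun _ => 1

lemma law_law [Fintype B] (p : A → ℝ) (f : A → B) (g : B → C) :
    law (law p f) g = law p (fun a => g (f a)) := by
  classical
  funext c
  have := sum_law_mul p f fun b => if g b = c then 1 else 0
  simpa [law] using this

lemma sum_law_pair_right [Fintype C] (p : A → ℝ) (f : A → B) (g : A → C) (b : B) :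
    ∑ c, law p (fun a => (f a, g a)) (b, c) = law p f b := by
  classical
  simp only [law, Prod.mk.injEq]
  rw [Finset.sum_comm]
  refine Finset.sum_congr rfl fun a _ => ?_
  by_cases h : f a = b <;> simp [h]

lemma sum_law_pair_left [Fintype B] (p : A → ℝ) (f : A → B) (g : A → C) (c : C) :
    ∑ b, law p (fun a => (f a, g a)) (b, c) = law p g c := by
  classical
  simp only [law, Prod.mk.injEq]
  rw [Finset.sum_comm]
  refine Finset.sum_congr rfl fun a _ => ?_
  by_cases h : g a = c <;> simp [h]

lemma law_comp_le {p : A → ℝ} (hp : ∀ a, 0 ≤ p a) (f : A → B) (g : B → C) (b : B) :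
    law p f b ≤ law p (fun a => g (f a)) (g b) := by
  classical
  refine Finset.sum_le_sum fun a _ => ?_
  by_cases h : f a = b
  · simp [h]
  · simp only [h, if_false]
    split_ifs <;> simp [hp]

lemma le_law {p : A → ℝ} (hp : ∀ a, 0 ≤ p a) (f : A → B) (a : A) : p a ≤ law p f (f a) := by
  classical
  have := Finset.single_le_sum (f := fun a' => if f a' = f a then p a' else 0)
    (fun a' _ => by split_ifs <;> simp [hp]) (Finset.mem_univ a)
  simpa [law] using this

lemma law_le_one [Fintype B] {p : A → ℝ} (hp : p ∈ stdSimplex ℝ A) (f : A → B) (b : B) :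
    law p f b ≤ 1 := by
  rw [← hp.2, ← sum_law p f]
  exact Finset.single_le_sum (f := law p f) (fun b' _ => law_nonneg hp.1 f b') (Finset.mem_univ b)

/-- The argument of the logarithm in `condMutualInfo p f g h`, as a function of the values of
`f`, `g` and `h`: the likelihood ratio of the joint law to the law that makes `f` and `g`
conditionally independent given `h`. -/
noncomputable def densityRatio (p : A → ℝ) (f : A → B) (g : A → C) (h : A → D) (x : B × C × D) :
    ℝ :=
  (law p (fun a => (f a, g a, h a)) x * law p h x.2.2) /
    (law p (fun a => (f a, h a)) (x.1, x.2.2) * law p (fun a => (g a, h a)) x.2)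

lemma condMutualInfo_eq_sum [Fintype B] [Fintype C] [Fintype D]
    (p : A → ℝ) (f : A → B) (g : A → C) (h : A → D) :
    condMutualInfo p f g h = ∑ a, p a * Real.logb 2 (densityRatio p f g h (f a, g a, h a)) := by
  rw [← sum_law_mul p (fun a => (f a, g a, h a)) fun x => Real.logb 2 (densityRatio p f g h x),
    Fintype.sum_prod_type]
  simp only [Fintype.sum_prod_type, condMutualInfo, densityRatio]

lemma law_const {p : A → ℝ} (hp : ∑ a, p a = 1) (u : Unit) : law p (fun _ => ()) u = 1 := by
  classical
  simp [law, hp]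

lemma law_pair_unit (p : A → ℝ) (f : A → B) (b : B) :
    law p (fun a => (f a, ())) (b, ()) = law p f b := by
  classical
  simp [law]

lemma mutualInfo_eq_condMutualInfo [Fintype B] [Fintype C] {p : A → ℝ} (hp : ∑ a, p a = 1)
    (f : A → B) (g : A → C) :
    mutualInfo p f g = condMutualInfo p f g (fun _ => ()) := by
  classical
  have h3 : ∀ b c, law p (fun a => (f a, g a, ())) (b, c, ())
      = law p (fun a => (f a, g a)) (b, c) := by
    intro b c
    simp [law]
  simp only [mutualInfo, condMutualInfo, Fintype.sum_unique, PUnit.default_eq_unit, h3,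
    law_const hp, law_pair_unit, mul_one]

/-- The termwise form of the nonnegativity of divergence. -/
lemma sub_le_mul_log_div {a b : ℝ} (ha : 0 ≤ a) (hb : 0 ≤ b) (hab : b = 0 → a = 0) :
    a - b ≤ a * Real.log (a / b) := by
  rcases ha.eq_or_lt with rfl | ha
  · simpa using hb
  have hb : 0 < b := hb.lt_of_ne fun h => ha.ne' (hab h.symm)
  have h := Real.log_le_sub_one_of_pos (div_pos hb ha)
  rw [← inv_div, Real.log_inv]
  have h2 : a * (b / a) = b := by field_simp
  nlinarith

lemma condMutualInfo_nonneg [Fintype B] [Fintype C] [Fintype D] {p : A → ℝ}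
    (hp : ∀ a, 0 ≤ p a) (f : A → B) (g : A → C) (h : A → D) : 0 ≤ condMutualInfo p f g h := by
  have hterm : ∀ b c d, (law p (fun a => (f a, g a, h a)) (b, c, d) -
      law p (fun a => (f a, h a)) (b, d) * law p (fun a => (g a, h a)) (c, d) / law p h d) /
        Real.log 2 ≤
      law p (fun a => (f a, g a, h a)) (b, c, d) *
        Real.logb 2 ((law p (fun a => (f a, g a, h a)) (b, c, d) * law p h d) /
          (law p (fun a => (f a, h a)) (b, d) * law p (fun a => (g a, h a)) (c, d))) := by
    intro b c d
    have h1 := law_comp_le hp (fun a => (f a, g a, h a)) (fun x => (x.1, x.2.2)) (b, c, d)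
    have h2 := law_comp_le hp (fun a => (f a, g a, h a)) (fun x => x.2) (b, c, d)
    have h3 := law_comp_le hp (fun a => (f a, g a, h a)) (fun x => x.2.2) (b, c, d)
    dsimp only at h1 h2 h3
    have h0 := law_nonneg hp (fun a => (f a, g a, h a)) (b, c, d)
    have := sub_le_mul_log_div h0 (b := law p (fun a => (f a, h a)) (b, d) *
      law p (fun a => (g a, h a)) (c, d) / law p h d)
      (div_nonneg (mul_nonneg (law_nonneg hp _ _) (law_nonneg hp _ _)) (law_nonneg hp _ _))
      (by
        intro hz
        rcases div_eq_zero_iff.1 hz with hz | hz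
        · rcases mul_eq_zero.1 hz with hz | hz <;> linarith
        · linarith)
    rw [Real.logb, div_div_eq_mul_div] at *
    rw [← mul_div_assoc]
    exact div_le_div_of_nonneg_right this (Real.log_pos one_lt_two).le
  refine le_trans ?_ (Finset.sum_le_sum fun b _ => Finset.sum_le_sum fun c _ =>
    Finset.sum_le_sum fun d _ => hterm b c d)
  simp only [← Finset.sum_div, Finset.sum_sub_distrib]
  refine div_nonneg (sub_nonneg.2 (le_of_eq ?_)) (Real.log_pos one_lt_two).le
  have e1 : ∑ b, ∑ c, ∑ d, law p (fun a => (f a, g a, h a)) (b, c, d) = ∑ d, law p h d := by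
    rw [sum_law, ← sum_law p (fun a => (f a, g a, h a)), Fintype.sum_prod_type]
    simp only [Fintype.sum_prod_type]
  rw [e1]
  simp_rw [Finset.sum_comm (s := (Finset.univ : Finset C))]
  rw [Finset.sum_comm]
  refine Finset.sum_congr rfl fun d _ => ?_
  simp_rw [← Finset.sum_div, ← Finset.mul_sum, ← Finset.sum_mul, sum_law_pair_left]
  rw [mul_self_div_self]

lemma mutualInfo_nonneg [Fintype B] [Fintype C] {p : A → ℝ} (hp : p ∈ stdSimplex ℝ A)
    (f : A → B) (g : A → C) : 0 ≤ mutualInfo p f g := by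
  rw [mutualInfo_eq_condMutualInfo hp.2]
  exact condMutualInfo_nonneg hp.1 _ _ _

/-- A crude bound on mutual information that does not depend on the law. -/
lemma mutualInfo_le [Fintype B] [Fintype C] {p : A → ℝ} (hp : p ∈ stdSimplex ℝ A)
    (f : A → B) (g : A → C) :
    mutualInfo p f g ≤ Fintype.card B * (Fintype.card C * (1 / Real.log 2)) := by
  have h2 : 0 < Real.log 2 := Real.log_pos one_lt_two
  have hterm : ∀ b c, law p (fun a => (f a, g a)) (b, c) *
      Real.logb 2 (law p (fun a => (f a, g a)) (b, c) / (law p f b * law p g c)) ≤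
        1 / Real.log 2 := by
    intro b c
    have hb := law_comp_le hp.1 (fun a => (f a, g a)) (fun x => x.1) (b, c)
    have hc := law_comp_le hp.1 (fun a => (f a, g a)) (fun x => x.2) (b, c)
    dsimp only at hb hc
    have h0 := law_nonneg hp.1 (fun a => (f a, g a)) (b, c)
    set w := law p (fun a => (f a, g a)) (b, c)
    rw [Real.logb, ← mul_div_assoc]
    refine div_le_div_of_nonneg_right ?_ h2.le
    have hq : 0 ≤ w / (law p f b * law p g c) :=
      div_nonneg h0 (mul_nonneg (law_nonneg hp.1 _ _) (law_nonneg hp.1 _ _))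
    calc w * Real.log (w / (law p f b * law p g c))
        ≤ w * (w / (law p f b * law p g c)) :=
          mul_le_mul_of_nonneg_left (Real.log_le_self hq) h0
      _ = (w * w) / (law p f b * law p g c) := by ring
      _ ≤ 1 := div_le_one_of_le₀ (mul_le_mul hb hc h0 (law_nonneg hp.1 _ _))
          (mul_nonneg (law_nonneg hp.1 _ _) (law_nonneg hp.1 _ _))
  calc mutualInfo p f g ≤ ∑ _b : B, ∑ _c : C, 1 / Real.log 2 :=
        Finset.sum_le_sum fun b _ => Finset.sum_le_sum fun c _ => hterm b c
    _ = _ := by simp [Finset.sum_const, nsmul_eq_mul]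

end Law

/-! ### The averaged channel -/

lemma numMessages_pos (n : ℕ) (R : ℝ) : 0 < numMessages n R := Nat.ceil_pos.2 (by positivity)

/-- Applying a map to each coordinate of a product pmf gives the product of the image laws. -/
lemma law_prod {ι A B : Type*} [Fintype ι] [DecidableEq ι] [Fintype A] (w : ι → A → ℝ)
    (π : A → B) (b : ι → B) :
    law (fun z : ι → A => ∏ i, w i (z i)) (fun z i => π (z i)) b = ∏ i, law (w i) π (b i) := by
  classical
  simp only [law]
  rw [← sum_prod_eq_prod_sum (fun i a => if π a = b i then w i a else 0)]
  refine Finset.sum_congr rfl fun z _ => ?_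
  by_cases h : (fun i => π (z i)) = b
  · subst h
    simp
  · obtain ⟨i, hi⟩ := Function.ne_iff.1 h
    rw [if_neg h, Finset.prod_eq_zero (Finset.mem_univ i) (if_neg hi)]

namespace PrimitiveRelayChannel

variable {X S Y Y₁ : Type*} [Fintype Y] [Fintype Y₁]

lemma errGiven_nonneg (ch : PrimitiveRelayChannel X S Y Y₁) {n M L : ℕ}
    (c : RelayCode X Y Y₁ n M L) (s : Fin n → S) : 0 ≤ ch.errGiven c s :=
  mul_nonneg (by positivity) <| Finset.sum_nonneg fun m _ => Finset.sum_nonneg fun y _ =>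
    Finset.sum_nonneg fun y₁ _ => by
      split_ifs
      exacts [Finset.prod_nonneg fun i _ => (ch.W_mem _ _).1 _, le_rfl]

lemma numIndices_pos (ch : PrimitiveRelayChannel X S Y Y₁) (n : ℕ) : 0 < numIndices n ch.C₁ :=
  Nat.floor_pos.2 (Real.one_le_rpow one_le_two (mul_nonneg n.cast_nonneg ch.C₁_nonneg))

variable [Fintype S]

/-- The transition law of the memoryless channel that results from averaging over a state with
pmf `q`. -/
noncomputable def avgW (ch : PrimitiveRelayChannel X S Y Y₁) (q : S → ℝ) (x : X) (z : Y × Y₁) : ℝ :=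
  ∑ s, q s * ch.W x s z

variable (ch : PrimitiveRelayChannel X S Y Y₁) {q : S → ℝ}

lemma avgW_mem (hq : q ∈ stdSimplex ℝ S) (x : X) : ch.avgW q x ∈ stdSimplex ℝ (Y × Y₁) := by
  refine ⟨fun z => Finset.sum_nonneg fun s _ => mul_nonneg (hq.1 s) ((ch.W_mem x s).1 z), ?_⟩
  simp only [avgW]
  rw [Finset.sum_comm]
  simp only [← Finset.mul_sum, (ch.W_mem x _).2, mul_one, hq.2]

lemma sum_prod_state (q : S → ℝ) {n : ℕ} (x : Fin n → X) (z : Fin n → Y × Y₁) :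
    ∑ s : Fin n → S, (∏ i, q (s i)) * ∏ i, ch.W (x i) (s i) (z i) = ∏ i, ch.avgW q (x i) (z i) := by
  simp only [← Finset.prod_mul_distrib]
  exact sum_prod_eq_prod_sum fun i s => q s * ch.W (x i) s (z i)

/-- The error probability of a code under i.i.d. states is its error probability over the averaged
channel. -/
lemma err_eq (q : S → ℝ) {n M L : ℕ} (c : RelayCode X Y Y₁ n M L) :
    ch.err q c = (1 / (M : ℝ)) * ∑ m : Fin M, ∑ z : Fin n → Y × Y₁,
      (∏ i, ch.avgW q (c.enc m i) (z i)) *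
        if c.dec (fun i => (z i).1) (c.relay fun i => (z i).2) ≠ m then 1 else 0 := by
  have h1 : ∀ s, ch.errGiven c s = (1 / (M : ℝ)) * ∑ m : Fin M, ∑ z : Fin n → Y × Y₁,
      (∏ i, ch.W (c.enc m i) (s i) (z i)) *
        if c.dec (fun i => (z i).1) (c.relay fun i => (z i).2) ≠ m then 1 else 0 := by
    intro s
    rw [errGiven]
    congr 1
    refine Finset.sum_congr rfl fun m _ => ?_
    rw [← Fintype.sum_prod_type']
    refine (Fintype.sum_equiv (Equiv.arrowProdEquivProdArrow (Fin n) (fun _ => Y) fun _ => Y₁)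
      _ _ fun z => ?_).symm
    simp [Equiv.arrowProdEquivProdArrow]
  simp only [err, h1, Finset.mul_sum]
  rw [Finset.sum_comm]
  refine Finset.sum_congr rfl fun m _ => ?_
  rw [Finset.sum_comm]
  refine Finset.sum_congr rfl fun z _ => ?_
  rw [← sum_prod_state, Finset.sum_mul, Finset.mul_sum]
  exact Finset.sum_congr rfl fun s _ => by ring

lemma err_nonneg (hq : q ∈ stdSimplex ℝ S) {n M L : ℕ} (c : RelayCode X Y Y₁ n M L) :
    0 ≤ ch.err q c :=
  Finset.sum_nonneg fun s _ =>
    mul_nonneg (Finset.prod_nonneg fun _ _ => hq.1 _) (ch.errGiven_nonneg c s)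

lemma correct_add_err (hq : q ∈ stdSimplex ℝ S) {n M L : ℕ} (hM : 0 < M)
    (c : RelayCode X Y Y₁ n M L) :
    (1 / (M : ℝ)) * (∑ m : Fin M, ∑ z : Fin n → Y × Y₁, (∏ i, ch.avgW q (c.enc m i) (z i)) *
      if c.dec (fun i => (z i).1) (c.relay fun i => (z i).2) = m then 1 else 0) + ch.err q c
      = 1 := by
  rw [err_eq, ← mul_add, ← Finset.sum_add_distrib]
  have h : ∀ m : Fin M, (∑ z : Fin n → Y × Y₁, (∏ i, ch.avgW q (c.enc m i) (z i)) *
      if c.dec (fun i => (z i).1) (c.relay fun i => (z i).2) = m then (1 : ℝ) else 0) +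
      (∑ z : Fin n → Y × Y₁, (∏ i, ch.avgW q (c.enc m i) (z i)) *
      if c.dec (fun i => (z i).1) (c.relay fun i => (z i).2) ≠ m then (1 : ℝ) else 0) = 1 := by
    intro m
    rw [← Finset.sum_add_distrib]
    refine Eq.trans ?_ (sum_prod_eq_one fun i => (ch.avgW_mem hq (c.enc m i)).2)
    refine Finset.sum_congr rfl fun z _ => ?_
    by_cases hz : c.dec (fun i => (z i).1) (c.relay fun i => (z i).2) = m <;> simp [hz]
  simp only [h]
  have : (M : ℝ) ≠ 0 := by positivity
  simp [this]

lemma err_le_one (hq : q ∈ stdSimplex ℝ S) {n M L : ℕ} (hM : 0 < M) (c : RelayCode X Y Y₁ n M L) :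
    ch.err q c ≤ 1 := by
  have h := ch.correct_add_err hq hM c
  have : 0 ≤ (1 / (M : ℝ)) * (∑ m : Fin M, ∑ z : Fin n → Y × Y₁,
      (∏ i, ch.avgW q (c.enc m i) (z i)) *
        if c.dec (fun i => (z i).1) (c.relay fun i => (z i).2) = m then 1 else 0) :=
    mul_nonneg (by positivity) <| Finset.sum_nonneg fun m _ => Finset.sum_nonneg fun z _ =>
      mul_nonneg (Finset.prod_nonneg fun i _ => (ch.avgW_mem hq _).1 _) (by split_ifs <;> simp)
  linarith

/-- For a fixed state pmf some member of a random code is at least as good as the random code. -/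
lemma exists_err_le_randomErr (hq : q ∈ stdSimplex ℝ S) {n M L : ℕ} (hM : 0 < M)
    (c : RandomRelayCode X Y Y₁ n M L) : ∃ c' : RelayCode X Y Y₁ n M L,
      ch.err q c' ≤ ch.randomErr q c := by
  by_contra! hc
  have hs : Summable fun γ => (c.μ γ).toReal := ENNReal.summable_toReal c.μ.tsum_coe_ne_top
  have h1 : ∑' γ, (c.μ γ).toReal = 1 := by
    rw [← ENNReal.tsum_toReal_eq fun γ => c.μ.apply_ne_top γ, c.μ.tsum_coe, ENNReal.toReal_one]
  have hs2 : Summable fun γ => (c.μ γ).toReal * ch.err q (c.code γ) :=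
    Summable.of_nonneg_of_le (fun γ => mul_nonneg ENNReal.toReal_nonneg (ch.err_nonneg hq _))
      (fun γ => mul_le_of_le_one_right ENNReal.toReal_nonneg (ch.err_le_one hq hM _)) hs
  obtain ⟨γ, hγ⟩ := c.μ.support_nonempty
  have hpos : 0 < (c.μ γ).toReal := ENNReal.toReal_pos hγ (c.μ.apply_ne_top γ)
  have := Summable.tsum_lt_tsum (f := fun γ => (c.μ γ).toReal * ch.randomErr q c)
    (fun γ => mul_le_mul_of_nonneg_left (hc _).le ENNReal.toReal_nonneg)
    (mul_lt_mul_of_pos_left (hc (c.code γ)) hpos) (hs.mul_right _) hs2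
  rw [tsum_mul_right, h1, one_mul] at this
  exact lt_irrefl _ this

end PrimitiveRelayChannel

/-! ### A converse for list decoding -/

section ListConverse

variable {X Z : Type*} [Fintype Z] {n M ℓ : ℕ}

/-- A list-decoding form of Fano's inequality. It is the variational lower bound on the divergence
between the joint law of message and output and the product of the uniform law with an arbitrary
memoryless output law `r`, applied to `log (M / ℓ)` times the indicator of correct decoding. -/
lemma mul_log_le_of_list_decoding (hM : 0 < M) (hℓ : 0 < ℓ) (hℓM : ℓ ≤ M) (V : X → Z → ℝ)
    (hV : ∀ x, V x ∈ stdSimplex ℝ Z) (r : Z → ℝ) (hr : r ∈ stdSimplex ℝ Z)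
    (enc : Fin M → Fin n → X) (hVr : ∀ m i ζ, r ζ = 0 → V (enc m i) ζ = 0)
    (Lst : (Fin n → Z) → Finset (Fin M)) (hL : ∀ z, (Lst z).card ≤ ℓ) {ε : ℝ}
    (hε : 1 - ε ≤ (1 / (M : ℝ)) * ∑ m, ∑ z : Fin n → Z, (∏ i, V (enc m i) (z i)) *
      if m ∈ Lst z then 1 else 0) :
    (1 - ε) * Real.log (M / ℓ) ≤
      (1 / (M : ℝ)) * (∑ m, ∑ i, ∑ ζ, V (enc m i) ζ * Real.log (V (enc m i) ζ / r ζ)) +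
        Real.log 2 := by
  have hM' : (0 : ℝ) < M := by exact_mod_cast hM
  have hℓ' : (0 : ℝ) < ℓ := by exact_mod_cast hℓ
  set t := Real.log (M / ℓ) with ht
  have ht0 : 0 ≤ t := Real.log_nonneg (by rw [le_div_iff₀ hℓ']; simpa using by exact_mod_cast hℓM)
  have het : Real.exp t = M / ℓ := Real.exp_log (by positivity)
  set P : Fin M → (Fin n → Z) → ℝ := fun m z => ∏ i, V (enc m i) (z i) with hP
  set χ : Fin M → (Fin n → Z) → ℝ := fun m z => if m ∈ Lst z then 1 else 0 with hχ
  have hP0 : ∀ m z, 0 ≤ P m z := fun m z => Finset.prod_nonneg fun i _ => (hV _).1 _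
  have hP1 : ∀ m, ∑ z, P m z = 1 := fun m => sum_prod_eq_one fun i => (hV (enc m i)).2
  have hr0 : ∀ z : Fin n → Z, 0 ≤ ∏ i, r (z i) := fun z => Finset.prod_nonneg fun i _ => hr.1 _
  have hr1 : ∑ z : Fin n → Z, ∏ i, r (z i) = 1 := sum_prod_eq_one fun _ => hr.2
  -- the reference measure `r ^ n * exp (t * χ) / 2`, whose total mass is at most `M`
  have hterm : ∀ m z, P m z - (∏ i, r (z i)) * (Real.exp (t * χ m z) / 2) ≤
      P m z * (∑ i, Real.log (V (enc m i) (z i) / r (z i))) - t * (P m z * χ m z) +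
        P m z * Real.log 2 := by
    intro m z
    rcases (hP0 m z).eq_or_lt with h0 | hpos
    · rw [← h0]
      have := mul_nonneg (hr0 z) (div_nonneg (Real.exp_pos (t * χ m z)).le zero_le_two)
      simp only [zero_mul, mul_zero, sub_zero, add_zero]
      linarith
    have hVpos : ∀ i, 0 < V (enc m i) (z i) := fun i =>
      ((hV _).1 _).lt_of_ne' fun h => hpos.ne' (Finset.prod_eq_zero (Finset.mem_univ i) h)
    have hrpos : ∀ i, 0 < r (z i) := fun i =>
      (hr.1 _).lt_of_ne' fun h => (hVpos i).ne' (hVr m i _ h)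
    have hrp : 0 < ∏ i, r (z i) := Finset.prod_pos fun i _ => hrpos i
    have hb : 0 < (∏ i, r (z i)) * (Real.exp (t * χ m z) / 2) := by positivity
    refine (sub_le_mul_log_div hpos.le hb.le fun h => absurd h hb.ne').trans (le_of_eq ?_)
    rw [Real.log_div hpos.ne' hb.ne', Real.log_mul hrp.ne' (by positivity),
      Real.log_div (Real.exp_pos _).ne' two_ne_zero, Real.log_exp, hP,
      Real.log_prod fun i _ => (hVpos i).ne', Real.log_prod fun i _ => (hrpos i).ne']
    simp only [fun i => Real.log_div (hVpos i).ne' (hrpos i).ne', Finset.sum_sub_distrib]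
    ring
  have hmass : ∑ m, ∑ z : Fin n → Z, (∏ i, r (z i)) * (Real.exp (t * χ m z) / 2) ≤ M := by
    have h1 : ∀ m z, Real.exp (t * χ m z) ≤ M / ℓ * χ m z + 1 := by
      intro m z
      by_cases h : m ∈ Lst z
      · simp [hχ, h, het]
      · simp [hχ, h]
    calc ∑ m, ∑ z : Fin n → Z, (∏ i, r (z i)) * (Real.exp (t * χ m z) / 2)
        = ∑ z : Fin n → Z, (∏ i, r (z i)) * ((∑ m, Real.exp (t * χ m z)) / 2) := by
          rw [Finset.sum_comm]
          simp only [Finset.mul_sum, Finset.sum_div]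
      _ ≤ ∑ z : Fin n → Z, (∏ i, r (z i)) * M := by
          refine Finset.sum_le_sum fun z _ => mul_le_mul_of_nonneg_left ?_ (hr0 z)
          have h2 : ∑ m, χ m z ≤ ℓ := by
            simpa [hχ] using (by exact_mod_cast hL z : ((Lst z).card : ℝ) ≤ ℓ)
          have h3 : ∑ m, Real.exp (t * χ m z) ≤ M / ℓ * ∑ m, χ m z + M := by
            refine (Finset.sum_le_sum fun m _ => h1 m z).trans (le_of_eq ?_)
            rw [Finset.sum_add_distrib, Finset.mul_sum]
            simp
          have h4 : (M : ℝ) / ℓ * ∑ m, χ m z ≤ M := by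
            refine (mul_le_mul_of_nonneg_left h2 (by positivity)).trans (le_of_eq ?_)
            field_simp
          linarith
      _ = M := by rw [← Finset.sum_mul, hr1, one_mul]
  have hsum := Finset.sum_le_sum fun m (_ : m ∈ Finset.univ) =>
    Finset.sum_le_sum fun z (_ : z ∈ Finset.univ) => hterm m z
  simp only [Finset.sum_add_distrib, Finset.sum_sub_distrib, hP1, ← Finset.sum_mul,
    ← Finset.mul_sum, Finset.sum_const, Finset.card_univ, Fintype.card_fin, nsmul_eq_mul,
    mul_one] at hsum
  have hmarg : ∀ m, ∑ z, P m z * (∑ i, Real.log (V (enc m i) (z i) / r (z i))) =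
      ∑ i, ∑ ζ, V (enc m i) ζ * Real.log (V (enc m i) ζ / r ζ) := by
    intro m
    simp only [Finset.mul_sum]
    rw [Finset.sum_comm]
    exact Finset.sum_congr rfl fun i _ => sum_prod_mul_apply (w := fun i => V (enc m i))
      (fun i => (hV _).2) i fun ζ => Real.log (V (enc m i) ζ / r ζ)
  simp only [hmarg] at hsum
  have h5 := mul_le_mul_of_nonneg_left hε ht0
  set D := ∑ m, ∑ i, ∑ ζ, V (enc m i) ζ * Real.log (V (enc m i) ζ / r ζ)
  set E := ∑ m, ∑ z, P m z * χ m z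
  have h6 : t * E ≤ D + M * Real.log 2 := by linarith
  have h7 : t * ((1 / (M : ℝ)) * E) ≤ (1 / (M : ℝ)) * D + Real.log 2 := by
    have := mul_le_mul_of_nonneg_left h6 (by positivity : (0 : ℝ) ≤ 1 / M)
    calc t * ((1 / (M : ℝ)) * E) = 1 / M * (t * E) := by ring
      _ ≤ _ := this
      _ = _ := by field_simp
  linarith

end ListConverse

/-! ### The cutset bound -/

section Cutset

variable {X Z : Type*}

open Classical in
/-- The empirical distribution of the letters of a codebook. -/
noncomputable def codebookType {n M : ℕ} (enc : Fin M → Fin n → X) (x : X) : ℝ :=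
  (∑ m, ∑ i, if enc m i = x then 1 else 0) / (M * n)

lemma sum_codebookType_mul [Fintype X] {n M : ℕ} (enc : Fin M → Fin n → X) (G : X → ℝ) :
    ∑ x, codebookType enc x * G x = (∑ m, ∑ i, G (enc m i)) / (M * n) := by
  classical
  simp only [codebookType, div_mul_eq_mul_div, Finset.sum_mul, ← Finset.sum_div]
  congr 1
  rw [Finset.sum_comm]
  refine Finset.sum_congr rfl fun m _ => ?_
  rw [Finset.sum_comm]
  exact Finset.sum_congr rfl fun i _ => by simp

lemma codebookType_mem [Fintype X] {n M : ℕ} (hn : 0 < n) (hM : 0 < M) (enc : Fin M → Fin n → X) :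
    codebookType enc ∈ stdSimplex ℝ X := by
  classical
  refine ⟨fun x => div_nonneg (Finset.sum_nonneg fun m _ => Finset.sum_nonneg fun i _ => by
    split_ifs <;> simp) (by positivity), ?_⟩
  have := sum_codebookType_mul enc fun _ => 1
  simp only [mul_one, Finset.sum_const, Finset.card_univ, Fintype.card_fin, nsmul_eq_mul] at this
  rw [this]
  exact div_self (by positivity)

lemma codebookType_pos {n M : ℕ} (enc : Fin M → Fin n → X) (m : Fin M) (i : Fin n) :
    0 < codebookType enc (enc m i) := by
  classical
  have hM : 0 < M := m.pos
  have hn : 0 < n := i.pos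
  refine div_pos ?_ (by positivity)
  refine Finset.sum_pos' (fun m _ => Finset.sum_nonneg fun i _ => by split_ifs <;> simp)
    ⟨m, Finset.mem_univ m, ?_⟩
  exact Finset.sum_pos' (fun i _ => by split_ifs <;> simp) ⟨i, Finset.mem_univ i, by simp⟩

/-- Mutual information between the input and a function of the output of a channel, in nats. -/
lemma mutualInfo_mul_log_two [Fintype X] [Fintype Z] {Z' : Type*} [Fintype Z'] (p : X → ℝ)
    (hp : ∀ x, 0 ≤ p x)
    (V : X → Z' → ℝ) (hV : ∀ x, V x ∈ stdSimplex ℝ Z') (π : Z' → Z) :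
    mutualInfo (fun a : X × Z' => p a.1 * V a.1 a.2) (fun a => a.1) (fun a => π a.2) * Real.log 2 =
      ∑ x, p x * ∑ ζ, law (V x) π ζ *
        Real.log (law (V x) π ζ / ∑ x', p x' * law (V x') π ζ) := by
  classical
  have h1 : ∀ x ζ, law (fun a : X × Z' => p a.1 * V a.1 a.2) (fun a => (a.1, π a.2)) (x, ζ)
      = p x * law (V x) π ζ := by
    intro x ζ
    simp only [law, Fintype.sum_prod_type, Prod.mk.injEq]
    rw [Finset.sum_eq_single x]
    · simp [Finset.mul_sum]
    · intro x' _ hx'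
      simp [hx']
    · simp
  have h2 : ∀ x, law (fun a : X × Z' => p a.1 * V a.1 a.2) (fun a => a.1) x = p x := by
    intro x
    rw [← sum_law_pair_right _ (fun a : X × Z' => a.1) (fun a => π a.2)]
    simp only [h1, ← Finset.mul_sum, sum_law, (hV x).2, mul_one]
  have h3 : ∀ ζ, law (fun a : X × Z' => p a.1 * V a.1 a.2) (fun a => π a.2) ζ
      = ∑ x', p x' * law (V x') π ζ := by
    intro ζ
    rw [← sum_law_pair_left _ (fun a : X × Z' => a.1) (fun a => π a.2)]
    simp only [h1]
  simp only [mutualInfo, h1, h2, h3]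
  rw [Finset.sum_mul]
  refine Finset.sum_congr rfl fun x _ => ?_
  rw [Finset.sum_mul, Finset.mul_sum]
  refine Finset.sum_congr rfl fun ζ _ => ?_
  rcases (hp x).eq_or_lt with h0 | h0
  · simp [← h0]
  · rw [mul_div_mul_left _ _ h0.ne', Real.logb]
    have : Real.log 2 ≠ 0 := (Real.log_pos one_lt_two).ne'
    field_simp

end Cutset

namespace PrimitiveRelayChannel

variable {X S Y Y₁ : Type*} [Fintype X] [Fintype S] [Fintype Y] [Fintype Y₁]
  (ch : PrimitiveRelayChannel X S Y Y₁) {q : S → ℝ}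

lemma jointX_mem (hq : q ∈ stdSimplex ℝ S) {p : X → ℝ} (hp : p ∈ stdSimplex ℝ X) :
    ch.jointX q p ∈ stdSimplex ℝ (X × (Y × Y₁)) := by
  refine ⟨fun a => mul_nonneg (hp.1 _) ((ch.avgW_mem hq a.1).1 a.2), ?_⟩
  rw [Fintype.sum_prod_type]
  have := fun x => (ch.avgW_mem hq x).2
  simp only [avgW] at this
  simp only [jointX, ← Finset.mul_sum, this, mul_one, hp.2]

/-- If the receiver can form, from the function `π` of the outputs, a list of at most `ℓ` messages
containing the decoded one, then the number of messages is limited by the mutual information across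
the cut at the codebook's own input distribution. Using the output law induced by that distribution
as the reference law makes convexity and chain-rule arguments unnecessary. -/
lemma mul_log_le_mutualInfo (hq : q ∈ stdSimplex ℝ S) {n M L ℓ : ℕ} (hn : 0 < n) (hM : 0 < M)
    (hℓ : 0 < ℓ) (hℓM : ℓ ≤ M) (c : RelayCode X Y Y₁ n M L) {Z : Type*} [Fintype Z]
    (π : Y × Y₁ → Z) (Lst : (Fin n → Z) → Finset (Fin M)) (hL : ∀ z, (Lst z).card ≤ ℓ)
    (hdec : ∀ z : Fin n → Y × Y₁,
      c.dec (fun i => (z i).1) (c.relay fun i => (z i).2) ∈ Lst fun i => π (z i)) {ε : ℝ}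
    (hε : ch.err q c ≤ ε) :
    (1 - ε) * Real.logb 2 (M / ℓ) ≤
      n * mutualInfo (ch.jointX q (codebookType c.enc)) (fun a => a.1) (fun a => π a.2) + 1 := by
  classical
  have hW := ch.avgW_mem hq
  set p := codebookType c.enc with hp
  have hpm : p ∈ stdSimplex ℝ X := codebookType_mem hn hM _
  set V : X → Z → ℝ := fun x => law (ch.avgW q x) π with hV
  have hVm : ∀ x, V x ∈ stdSimplex ℝ Z := fun x =>
    ⟨law_nonneg (hW x).1 π, by rw [hV, sum_law, (hW x).2]⟩
  set r : Z → ℝ := fun ζ => ∑ x, p x * V x ζ with hr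
  have hr0 : ∀ ζ, 0 ≤ r ζ := fun ζ =>
    Finset.sum_nonneg fun x _ => mul_nonneg (hpm.1 x) ((hVm x).1 ζ)
  have hrm : r ∈ stdSimplex ℝ Z := by
    refine ⟨hr0, ?_⟩
    rw [hr, Finset.sum_comm]
    simp only [← Finset.mul_sum, (hVm _).2, mul_one, hpm.2]
  have hVr : ∀ m i ζ, r ζ = 0 → V (c.enc m i) ζ = 0 := by
    intro m i ζ h0
    have := (Finset.sum_eq_zero_iff_of_nonneg fun x _ =>
      mul_nonneg (hpm.1 x) ((hVm x).1 ζ)).1 h0 (c.enc m i) (Finset.mem_univ _)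
    exact (mul_eq_zero.1 this).resolve_left (codebookType_pos c.enc m i).ne'
  have hcorr : 1 - ε ≤ (1 / (M : ℝ)) * ∑ m, ∑ z : Fin n → Z, (∏ i, V (c.enc m i) (z i)) *
      if m ∈ Lst z then 1 else 0 := by
    have h1 := ch.correct_add_err hq hM c
    have h2 : ∀ m, ∑ z : Fin n → Y × Y₁, (∏ i, ch.avgW q (c.enc m i) (z i)) *
        (if c.dec (fun i => (z i).1) (c.relay fun i => (z i).2) = m then 1 else 0) ≤
        ∑ z : Fin n → Z, (∏ i, V (c.enc m i) (z i)) * (if m ∈ Lst z then (1 : ℝ) else 0) := by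
      intro m
      simp only [hV, ← law_prod (fun i => ch.avgW q (c.enc m i)) π]
      rw [sum_law_mul]
      refine Finset.sum_le_sum fun z _ =>
        mul_le_mul_of_nonneg_left ?_ (Finset.prod_nonneg fun i _ => (hW _).1 _)
      by_cases h : c.dec (fun i => (z i).1) (c.relay fun i => (z i).2) = m
      · have := hdec z
        rw [h] at this
        simp [h, this]
      · rw [if_neg h]
        split_ifs <;> simp
    have h3 := mul_le_mul_of_nonneg_left (Finset.sum_le_sum fun m (_ : m ∈ Finset.univ) => h2 m)
      (by positivity : (0 : ℝ) ≤ 1 / M)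
    linarith
  have key := mul_log_le_of_list_decoding hM hℓ hℓM V hVm r hrm c.enc hVr Lst hL hcorr
  have hI := mutualInfo_mul_log_two p hpm.1 (ch.avgW q) hW π
  rw [sum_codebookType_mul c.enc] at hI
  have hjoint : ch.jointX q p = fun a => p a.1 * ch.avgW q a.1 a.2 := rfl
  rw [hjoint]
  set I := mutualInfo (fun a : X × (Y × Y₁) => p a.1 * ch.avgW q a.1 a.2) (fun a => a.1)
    (fun a => π a.2)
  have hl2 : 0 < Real.log 2 := Real.log_pos one_lt_two
  have hn' : (0 : ℝ) < n := by exact_mod_cast hn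
  have hM' : (0 : ℝ) < M := by exact_mod_cast hM
  set D := ∑ m, ∑ i, ∑ ζ, V (c.enc m i) ζ * Real.log (V (c.enc m i) ζ / r ζ)
  have hD : (1 / (M : ℝ)) * D = n * I * Real.log 2 := by
    have : I * Real.log 2 = D / (M * n) := hI
    rw [mul_assoc, this]
    field_simp
  rw [hD] at key
  rw [Real.logb, ← mul_div_assoc, div_le_iff₀ hl2]
  linarith

lemma bddAbove_cutset (hq : q ∈ stdSimplex ℝ S) : BddAbove (Set.range fun p : stdSimplex ℝ X =>
    min (mutualInfo (ch.jointX q p) (fun a => a.1) (fun a => a.2.1) + ch.C₁)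
      (mutualInfo (ch.jointX q p) (fun a => a.1) (fun a => a.2))) := by
  refine ⟨Fintype.card X * (Fintype.card (Y × Y₁) * (1 / Real.log 2)), ?_⟩
  rintro _ ⟨p, rfl⟩
  exact (min_le_right _ _).trans (mutualInfo_le (ch.jointX_mem hq p.2) _ _)

/-- The weak converse at a fixed state pmf. -/
lemma le_cutset_of_randomAchievable [Nonempty X] {Q : Set (S → ℝ)} (hqQ : q ∈ Q)
    (hq : q ∈ stdSimplex ℝ S) {R : ℝ} (hR : ch.RandomAchievable Q R) :
    R ≤ ⨆ p : stdSimplex ℝ X,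
      min (mutualInfo (ch.jointX q p) (fun a => a.1) (fun a => a.2.1) + ch.C₁)
        (mutualInfo (ch.jointX q p) (fun a => a.1) (fun a => a.2)) := by
  classical
  have hbdd := ch.bddAbove_cutset hq
  rcases le_or_gt R 0 with hR0 | hR0
  · have p₀ : stdSimplex ℝ X := ⟨Pi.single (Classical.arbitrary X) 1, single_mem_stdSimplex ℝ _⟩
    refine hR0.trans (le_trans ?_ (le_ciSup hbdd p₀))
    exact le_min (add_nonneg (mutualInfo_nonneg (ch.jointX_mem hq p₀.2) _ _) ch.C₁_nonneg)
      (mutualInfo_nonneg (ch.jointX_mem hq p₀.2) _ _)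
  refine le_of_forall_pos_le_add fun η hη => ?_
  obtain ⟨N, hN⟩ := hR (min (1 / 2) (η / (2 * R))) (by positivity)
  set ε := min (1 / 2) (η / (2 * R)) with hε
  have hε1 : ε ≤ 1 / 2 := min_le_left _ _
  have hε0 : 0 < ε := by positivity
  have hεR : ε * R ≤ η / 2 := by
    refine (mul_le_mul_of_nonneg_right (min_le_right _ _) hR0.le).trans (le_of_eq ?_)
    field_simp
  obtain ⟨n₀, hn₀⟩ := exists_nat_gt (2 / η)
  set n := max (max N n₀) 1 with hn
  have hn1 : 0 < n := by simp [hn]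
  have hnr : (0 : ℝ) < n := by exact_mod_cast hn1
  have hnη : 1 ≤ n * (η / 2) := by
    have h1 : (n₀ : ℝ) ≤ n := by
      exact_mod_cast (le_max_right N n₀).trans (le_max_left _ _)
    have h2 : 2 / η ≤ n := hn₀.le.trans h1
    rw [div_le_iff₀ hη] at h2
    linarith
  obtain ⟨c, hc⟩ := hN n ((le_max_left N n₀).trans (le_max_left _ _))
  have hM := numMessages_pos n R
  have hL := ch.numIndices_pos n
  obtain ⟨c', hc'⟩ := ch.exists_err_le_randomErr hq hM c
  have herr := hc'.trans (hc q hqQ)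
  have hM1 : n * R ≤ Real.logb 2 (numMessages n R) := by
    rw [Real.le_logb_iff_rpow_le one_lt_two (by exact_mod_cast hM)]
    exact Nat.le_ceil _
  have hL1 : Real.logb 2 (numIndices n ch.C₁) ≤ n * ch.C₁ := by
    rw [Real.logb_le_iff_le_rpow one_lt_two (by exact_mod_cast hL)]
    exact Nat.floor_le (by positivity)
  set p : stdSimplex ℝ X := ⟨codebookType c'.enc, codebookType_mem hn1 hM _⟩
  have hmem := ch.jointX_mem hq p.2
  have hb1 : (1 - ε) * R ≤ mutualInfo (ch.jointX q p) (fun a => a.1) (fun a => a.2.1) + ch.C₁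
      + η / 2 := by
    have hI0 : 0 ≤ mutualInfo (ch.jointX q p) (fun a => a.1) (fun a => a.2.1) :=
      mutualInfo_nonneg hmem _ _
    set I := mutualInfo (ch.jointX q p) (fun a => a.1) (fun a => a.2.1)
    rcases le_total (numIndices n ch.C₁) (numMessages n R) with hLM | hLM
    · have := ch.mul_log_le_mutualInfo hq hn1 hM hL hLM c' (fun z => z.1)
        (fun y => Finset.univ.image (c'.dec y)) (fun y => by
          simpa using Finset.card_image_le (s := Finset.univ) (f := c'.dec y))
        (fun z => Finset.mem_image_of_mem _ (Finset.mem_univ _)) herr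
      rw [Real.logb_div (by positivity) (by positivity)] at this
      have h1 : (1 - ε) * (n * R - n * ch.C₁) ≤ n * I + 1 := by
        refine le_trans (mul_le_mul_of_nonneg_left ?_ (by linarith)) this
        linarith
      have h2 : 0 ≤ ε * (n * ch.C₁) := mul_nonneg hε0.le (mul_nonneg hnr.le ch.C₁_nonneg)
      refine le_of_mul_le_mul_left ?_ hnr
      linarith
    -- with more link indices than messages the list bound is void, but then already `R ≤ C₁`
    · have h1 : Real.logb 2 (numMessages n R) ≤ Real.logb 2 (numIndices n ch.C₁) :=
        Real.logb_le_logb_of_le one_lt_two (by exact_mod_cast hM) (by exact_mod_cast hLM)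
      have h2 : R ≤ ch.C₁ := le_of_mul_le_mul_left (by linarith) hnr
      have h3 : 0 ≤ ε * R := mul_nonneg hε0.le hR0.le
      linarith
  have hb2 : (1 - ε) * R ≤ mutualInfo (ch.jointX q p) (fun a => a.1) (fun a => a.2) + η / 2 := by
    have := ch.mul_log_le_mutualInfo hq hn1 hM one_pos hM c' (fun z => z)
      (fun z => {c'.dec (fun i => (z i).1) (c'.relay fun i => (z i).2)}) (fun z => by simp)
      (fun z => by simp) herr
    have h1 : (1 - ε) * (n * R) ≤
        n * mutualInfo (ch.jointX q p) (fun a => a.1) (fun a => a.2) + 1 := by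
      refine le_trans (mul_le_mul_of_nonneg_left ?_ (by linarith)) this
      simpa using hM1
    refine le_of_mul_le_mul_left ?_ hnr
    linarith
  have := le_ciSup hbdd p
  have h3 : (1 - ε) * R - η / 2 ≤
      min (mutualInfo (ch.jointX q p) (fun a => a.1) (fun a => a.2.1) + ch.C₁)
        (mutualInfo (ch.jointX q p) (fun a => a.1) (fun a => a.2)) :=
    le_min (by linarith) (by linarith)
  have h4 := h3.trans this
  linarith

theorem randomCapacity_le_rateCS [Nonempty X] {Q : Set (S → ℝ)} (hQ : Q ⊆ stdSimplex ℝ S)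
    (hQne : Q.Nonempty) : ch.randomCapacity Q ≤ ((ch.rateCS Q : ℝ) : EReal) := by
  have := hQne.to_subtype
  refine sSup_le ?_
  rintro _ ⟨R, hR, rfl⟩
  exact EReal.coe_le_coe_iff.2
    (le_ciInf fun q => ch.le_cutset_of_randomAchievable q.2 (hQ q.2) hR)

end PrimitiveRelayChannel

/-! ### Polynomially many dominating state pmfs -/

lemma exists_forall_le_two_mul {α : Type*} {Q : Set α} (hQ : Q.Nonempty) (h : α → ℝ)
    (h0 : ∀ q ∈ Q, 0 ≤ h q) (h1 : ∀ q ∈ Q, h q ≤ 1) : ∃ q' ∈ Q, ∀ q ∈ Q, h q ≤ 2 * h q' := by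
  have hbdd : BddAbove (h '' Q) := ⟨1, by rintro _ ⟨q, hq, rfl⟩; exact h1 q hq⟩
  have hle : ∀ q ∈ Q, h q ≤ sSup (h '' Q) := fun q hq => le_csSup hbdd ⟨q, hq, rfl⟩
  obtain ⟨q₀, hq₀⟩ := hQ
  rcases ((h0 q₀ hq₀).trans (hle q₀ hq₀)).eq_or_lt with hs | hs
  · exact ⟨q₀, hq₀, fun q hq => by linarith [hle q hq, h0 q₀ hq₀]⟩
  · obtain ⟨_, ⟨q', hq', rfl⟩, hlt⟩ := exists_lt_of_lt_csSup
      (Set.Nonempty.image h ⟨q₀, hq₀⟩) (half_lt_self hs)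
    exact ⟨q', hq', fun q hq => by linarith [hle q hq]⟩

/-- The probability that `q` assigns to a sequence is a monomial in `q` determined by the type of
the sequence. Choosing for each type a nearly maximizing member of `Q`, the i.i.d. laws of the
polynomially many chosen members dominate those of all members of `Q`; neither closedness nor
finiteness of `Q` is involved. -/
lemma exists_dominating_family {S : Type*} [Fintype S] [DecidableEq S] {Q : Set (S → ℝ)}
    (hQ : Q ⊆ stdSimplex ℝ S) (hQne : Q.Nonempty) (n : ℕ) :
    ∃ F : (S → Fin (n + 1)) → S → ℝ, (∀ T, F T ∈ Q) ∧
      ∀ q ∈ Q, ∀ s : Fin n → S, ∏ i, q (s i) ≤ 2 * ∑ T, ∏ i, F T (s i) := by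
  have hmax : ∀ T : S → Fin (n + 1), ∃ q' ∈ Q, ∀ q ∈ Q,
      ∏ a, q a ^ (T a : ℕ) ≤ 2 * ∏ a, q' a ^ (T a : ℕ) := fun T =>
    exists_forall_le_two_mul hQne (fun q : S → ℝ => ∏ a, q a ^ (T a : ℕ))
      (fun q hq => Finset.prod_nonneg fun a _ => pow_nonneg ((hQ hq).1 a) _)
      fun q hq => Finset.prod_le_one (fun a _ => pow_nonneg ((hQ hq).1 a) _) fun a _ =>
        pow_le_one₀ ((hQ hq).1 a) (mem_Icc_of_mem_stdSimplex (hQ hq) a).2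
  choose F hF hFmax using hmax
  refine ⟨F, hF, fun q hq s => ?_⟩
  let T : S → Fin (n + 1) := fun a =>
    ⟨(Finset.univ.filter fun i => s i = a).card, Nat.lt_succ_of_le <| by
      simpa using Finset.card_le_univ (Finset.univ.filter fun i => s i = a)⟩
  have hmono : ∀ p : S → ℝ, ∏ i, p (s i) = ∏ a, p a ^ (T a : ℕ) := fun p => by
    rw [← Finset.prod_fiberwise_of_maps_to (s := Finset.univ) (t := Finset.univ) (g := s)
      (fun _ _ => Finset.mem_univ _)]
    refine Finset.prod_congr rfl fun a _ => ?_
    rw [Finset.prod_congr rfl fun i hi => by rw [(Finset.mem_filter.1 hi).2], Finset.prod_const]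
  calc ∏ i, q (s i) = ∏ a, q a ^ (T a : ℕ) := hmono q
    _ ≤ 2 * ∏ a, F T a ^ (T a : ℕ) := hFmax T q hq
    _ = 2 * ∏ i, F T (s i) := by rw [hmono]
    _ ≤ 2 * ∑ T, ∏ i, F T (s i) := by
        refine mul_le_mul_of_nonneg_left ?_ zero_le_two
        exact Finset.single_le_sum (f := fun T => ∏ i, F T (s i))
          (fun T _ => Finset.prod_nonneg fun i _ => (hQ (hF T)).1 _) (Finset.mem_univ T)

lemma eventually_mul_pow_mul_exp_le (C : ℝ) (d : ℕ) {a b : ℝ} (hab : b < a) :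
    ∃ N : ℕ, ∀ n ≥ N, C * ((n : ℝ) + 1) ^ d * Real.exp (-(a * n)) ≤ Real.exp (-(b * n)) := by
  have h1 : Filter.Tendsto (fun x : ℝ => x ^ d * Real.exp (-((a - b) * x))) Filter.atTop
      (nhds 0) := by
    have := (isLittleO_pow_exp_pos_mul_atTop d (sub_pos.2 hab)).tendsto_div_nhds_zero
    simpa only [Real.exp_neg, div_eq_mul_inv] using this
  have h2 : Filter.Tendsto (fun n : ℕ => C * Real.exp (a - b) *
      (((n : ℝ) + 1) ^ d * Real.exp (-((a - b) * ((n : ℝ) + 1))))) Filter.atTop (nhds 0) := by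
    have := (h1.comp (Filter.tendsto_atTop_add_const_right _ 1 tendsto_natCast_atTop_atTop)
      ).const_mul (C * Real.exp (a - b))
    simpa only [mul_zero, Function.comp_def] using this
  obtain ⟨N, hN⟩ := Filter.eventually_atTop.1 (h2.eventually_le_const one_pos)
  refine ⟨N, fun n hn => ?_⟩
  have h3 := mul_le_mul_of_nonneg_right (hN n hn) (Real.exp_pos (-(b * n))).le
  rw [one_mul] at h3
  refine le_trans (le_of_eq ?_) h3
  have h4 : Real.exp (-(a * n)) =
      Real.exp (a - b) * Real.exp (-((a - b) * ((n : ℝ) + 1))) * Real.exp (-(b * n)) := by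
    rw [← Real.exp_add, ← Real.exp_add]
    congr 1
    ring
  rw [h4]
  ring

/-! ### A uniform Chernoff bound -/

lemma exp_le_one_add_add_sq_mul_max (x : ℝ) :
    Real.exp x ≤ 1 + x + x ^ 2 * max 1 (Real.exp x) := by
  have hm : (1 : ℝ) ≤ max 1 (Real.exp x) := le_max_left _ _
  have hm' : Real.exp x ≤ max 1 (Real.exp x) := le_max_right _ _
  rcases le_or_gt |x| 1 with h | h
  · have := (abs_le.1 (Real.abs_exp_sub_one_sub_id_le h)).2
    nlinarith [sq_nonneg x]
  · rcases lt_abs.1 h with h | h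
    · have := mul_le_mul_of_nonneg_right (show 1 ≤ x ^ 2 by nlinarith)
        (zero_le_one.trans hm)
      linarith
    · have : Real.exp x ≤ 1 := Real.exp_le_one_iff.2 (by linarith)
      nlinarith [sq_nonneg x]

section Chernoff

variable {Ω : Type*} [Fintype Ω] {P Z : Ω → ℝ} {I K l : ℝ}

/-- The moment generating function of the lower tail, controlled by a mean and a weighted second
moment only, hence uniformly over families on which those are controlled. -/
lemma sum_mul_exp_neg_le (hP : P ∈ stdSimplex ℝ Ω) (hI : I ≤ ∑ ω, P ω * Z ω)
    (hK : ∑ ω, P ω * (Z ω ^ 2 * max 1 (Real.exp (-Z ω / 2))) ≤ K) (hl0 : 0 ≤ l)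
    (hl1 : l ≤ 1 / 2) : ∑ ω, P ω * Real.exp (-(l * Z ω)) ≤ Real.exp (-(l * I) + l ^ 2 * K) := by
  have hterm : ∀ ω, P ω * Real.exp (-(l * Z ω)) ≤
      P ω - l * (P ω * Z ω) + l ^ 2 * (P ω * (Z ω ^ 2 * max 1 (Real.exp (-Z ω / 2)))) := by
    intro ω
    have h1 := exp_le_one_add_add_sq_mul_max (-(l * Z ω))
    have h2 : max 1 (Real.exp (-(l * Z ω))) ≤ max 1 (Real.exp (-Z ω / 2)) := by
      rcases le_total 0 (Z ω) with hz | hz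
      · have : Real.exp (-(l * Z ω)) ≤ 1 := Real.exp_le_one_iff.2 (by nlinarith)
        exact max_le (le_max_left _ _) (this.trans (le_max_left _ _))
      · exact max_le_max le_rfl (Real.exp_le_exp.2 (by nlinarith))
    have h3 := mul_le_mul_of_nonneg_left h2 (sq_nonneg (-(l * Z ω)))
    have h4 := mul_le_mul_of_nonneg_left (h1.trans (add_le_add_right h3 _)) (hP.1 ω)
    refine h4.trans (le_of_eq ?_)
    ring
  have hsum := Finset.sum_le_sum fun ω (_ : ω ∈ Finset.univ) => hterm ω
  rw [Finset.sum_add_distrib, Finset.sum_sub_distrib, hP.2, ← Finset.mul_sum,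
    ← Finset.mul_sum] at hsum
  have h5 := mul_le_mul_of_nonneg_left hI hl0
  have h6 := mul_le_mul_of_nonneg_left hK (sq_nonneg l)
  have h7 := Real.add_one_le_exp (-(l * I) + l ^ 2 * K)
  linarith

open Classical in
lemma sum_prod_lower_tail_le (hP : P ∈ stdSimplex ℝ Ω) (hI : I ≤ ∑ ω, P ω * Z ω)
    (hK : ∑ ω, P ω * (Z ω ^ 2 * max 1 (Real.exp (-Z ω / 2))) ≤ K) (hl0 : 0 ≤ l)
    (hl1 : l ≤ 1 / 2) (n : ℕ) (τ : ℝ) :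
    ∑ ω : Fin n → Ω, (∏ i, P (ω i)) * (if ∑ i, Z (ω i) < n * τ then 1 else 0) ≤
      Real.exp (-((l * (I - τ) - l ^ 2 * K) * n)) := by
  calc ∑ ω : Fin n → Ω, (∏ i, P (ω i)) * (if ∑ i, Z (ω i) < n * τ then 1 else 0)
      ≤ ∑ ω : Fin n → Ω, Real.exp (l * (n * τ)) * ∏ i, P (ω i) * Real.exp (-(l * Z (ω i))) := by
        refine Finset.sum_le_sum fun ω _ => ?_
        rw [Finset.prod_mul_distrib, ← Real.exp_sum, Finset.sum_neg_distrib, ← Finset.mul_sum,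
          mul_left_comm, ← Real.exp_add]
        refine mul_le_mul_of_nonneg_left ?_ (Finset.prod_nonneg fun i _ => hP.1 _)
        split_ifs with h
        · exact Real.one_le_exp (by nlinarith)
        · exact (Real.exp_pos _).le
    _ = Real.exp (l * (n * τ)) * (∑ ω, P ω * Real.exp (-(l * Z ω))) ^ n := by
        rw [← Finset.mul_sum, sum_prod_eq_prod_sum fun _ ω => P ω * Real.exp (-(l * Z ω))]
        simp
    _ ≤ Real.exp (l * (n * τ)) * Real.exp (-(l * I) + l ^ 2 * K) ^ n := by
        refine mul_le_mul_of_nonneg_left (pow_le_pow_left₀ ?_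
          (sum_mul_exp_neg_le hP hI hK hl0 hl1) n) (Real.exp_pos _).le
        exact Finset.sum_nonneg fun ω _ => mul_nonneg (hP.1 ω) (Real.exp_pos _).le
    _ = Real.exp (-((l * (I - τ) - l ^ 2 * K) * n)) := by
        rw [← Real.exp_nat_mul, ← Real.exp_add]
        congr 1
        ring

end Chernoff

/-! ### Universal likelihood-ratio tests -/

section UniversalTest

universe v

variable {S Ω T : Type*} [Fintype S] [Fintype Ω]

/-- The mixture of the laws `κ s` with weights `q s`. -/
noncomputable def mix (κ : S → Ω → ℝ) (q : S → ℝ) (ω : Ω) : ℝ := ∑ s, q s * κ s ω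

lemma mix_mem {κ : S → Ω → ℝ} (hκ : ∀ s, κ s ∈ stdSimplex ℝ Ω) {q : S → ℝ}
    (hq : q ∈ stdSimplex ℝ S) : mix κ q ∈ stdSimplex ℝ Ω := by
  refine ⟨fun z => Finset.sum_nonneg fun s _ => mul_nonneg (hq.1 s) ((hκ s).1 z), ?_⟩
  simp only [mix]
  rw [Finset.sum_comm]
  simp only [← Finset.mul_sum, (hκ _).2, mul_one, hq.2]

lemma prod_mix_le {κ : S → Ω → ℝ} (hκ : ∀ s, κ s ∈ stdSimplex ℝ Ω) {q : S → ℝ} {n : ℕ}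
    {ι : Type*} [Fintype ι] {F : ι → S → ℝ}
    (h : ∀ s : Fin n → S, ∏ i, q (s i) ≤ 2 * ∑ T, ∏ i, F T (s i)) (ω : Fin n → Ω) :
    ∏ i, mix κ q (ω i) ≤ 2 * ∑ T, ∏ i, mix κ (F T) (ω i) := by
  have hexp : ∀ q : S → ℝ, ∏ i, mix κ q (ω i) =
      ∑ s : Fin n → S, (∏ i, q (s i)) * ∏ i, κ (s i) (ω i) := by
    intro q
    simp only [← Finset.prod_mul_distrib]
    exact (sum_prod_eq_prod_sum fun i s => q s * κ s (ω i)).symm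
  simp only [hexp]
  rw [Finset.sum_comm, Finset.mul_sum]
  refine Finset.sum_le_sum fun s _ => ?_
  rw [← Finset.sum_mul, ← mul_assoc]
  exact mul_le_mul_of_nonneg_right (h s) (Finset.prod_nonneg fun i _ => (hκ _).1 _)

/-- A test that works for every `q ∈ Q` simultaneously. Under each `q ∈ Q` it misses `t ∘ ω` with
exponentially small probability, while a competitor whose letters are drawn independently of the
observation passes with probability at most `exp (-(τ * n))`. The test accepts when the likelihood
ratio of some member of a dominating family is large. In the second part `g i α` is what the test
sees at time `i` when the competitor's letter is `α`. -/
theorem exists_universal_test {κ : S → Ω → ℝ} (hκ : ∀ s, κ s ∈ stdSimplex ℝ Ω) (t : Ω → T)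
    {Q : Set (S → ℝ)} (hQ : Q ⊆ stdSimplex ℝ S) (hQne : Q.Nonempty) (ρ : (S → ℝ) → T → ℝ)
    (hρ0 : ∀ q ∈ Q, ∀ x, 0 ≤ ρ q x) (hρ : ∀ q ∈ Q, ∀ ω, 0 < mix κ q ω → 0 < ρ q (t ω))
    {I K τ : ℝ} (hI : ∀ q ∈ Q, I ≤ ∑ ω, mix κ q ω * Real.log (ρ q (t ω)))
    (hK : ∀ q ∈ Q, ∑ ω, mix κ q ω * (Real.log (ρ q (t ω)) ^ 2 *
      max 1 (Real.exp (-Real.log (ρ q (t ω)) / 2))) ≤ K) (hτ : τ < I) :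
    ∃ a : ℝ, 0 < a ∧ ∃ N : ℕ, ∀ n ≥ N, ∃ Θ : Set (Fin n → T),
      (∀ q ∈ Q, ∑ ω : Fin n → Ω, (∏ i, mix κ q (ω i)) *
        Θᶜ.indicator 1 (fun i => t (ω i)) ≤ Real.exp (-(a * n))) ∧
      ∀ {A : Type v} [Fintype A] (w : A → ℝ) (_ : ∀ α, 0 ≤ w α) (g : Fin n → A → T),
        (∀ q ∈ Q, ∀ i, ∑ α, w α * ρ q (g i α) ≤ 1) →
        ∑ α : Fin n → A, (∏ i, w (α i)) * Θ.indicator 1 (fun i => g i (α i)) ≤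
          Real.exp (-(τ * n)) := by
  classical
  -- the threshold `τ'` leaves room for the polynomial factors on both sides
  set τ' := (τ + I) / 2 with hτ'
  set δ := I - τ' with hδ
  have hδ0 : 0 < δ := by simp only [hδ, hτ']; linarith
  set K' := max K 1 with hK'
  have hK'0 : 0 < K' := lt_of_lt_of_le one_pos (le_max_right _ _)
  set l := min (1 / 2) (δ / (2 * K')) with hl
  have hl0 : 0 < l := by positivity
  have hlK : l * K' ≤ δ / 2 := by
    refine (mul_le_mul_of_nonneg_right (min_le_right _ _) hK'0.le).trans (le_of_eq ?_)
    field_simp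
  have ha0 : 0 < l * δ / 2 := by positivity
  obtain ⟨N₁, hN₁⟩ := eventually_mul_pow_mul_exp_le 2 (Fintype.card S)
    (show l * δ / 4 < l * δ / 2 by linarith)
  obtain ⟨N₂, hN₂⟩ := eventually_mul_pow_mul_exp_le 1 (Fintype.card S)
    (show τ < τ' by simp only [hτ']; linarith)
  refine ⟨l * δ / 4, by positivity, max N₁ N₂, fun n hn => ?_⟩
  obtain ⟨F, hFQ, hF⟩ := exists_dominating_family hQ hQne n
  have hcard : (Fintype.card (S → Fin (n + 1)) : ℝ) = ((n : ℝ) + 1) ^ Fintype.card S := by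
    simp
  refine ⟨{x | ∃ ty, Real.exp (τ' * n) ≤ ∏ i, ρ (F ty) (x i)}, fun q hq => ?_, ?_⟩
  · set Θ : Set (Fin n → T) := {x | ∃ ty, Real.exp (τ' * n) ≤ ∏ i, ρ (F ty) (x i)} with hΘ
    have hmiss : ∀ ty, ∑ ω : Fin n → Ω, (∏ i, mix κ (F ty) (ω i)) *
        Θᶜ.indicator 1 (fun i => t (ω i)) ≤ Real.exp (-(l * δ / 2 * n)) := by
      intro ty
      have hP := mix_mem hκ (hQ (hFQ ty))
      have hc := sum_prod_lower_tail_le hP (hI _ (hFQ ty))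
        ((hK _ (hFQ ty)).trans (le_max_left K 1)) hl0.le (min_le_left _ _) n τ'
      refine le_trans (Finset.sum_le_sum fun ω _ => ?_) (hc.trans (Real.exp_le_exp.2 ?_))
      · rcases (Finset.prod_nonneg fun i (_ : i ∈ Finset.univ) => hP.1 (ω i)).eq_or_lt
          with h0 | hpos
        · simp [← h0]
        refine mul_le_mul_of_nonneg_left ?_ hpos.le
        by_cases hω : (fun i => t (ω i)) ∈ Θ
        · rw [Set.indicator_of_notMem (by simpa using hω)]
          split_ifs <;> simp
        · rw [Set.indicator_of_mem (show _ ∈ Θᶜ from hω), if_pos]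
          · rfl
          have h1 : ∀ i, 0 < ρ (F ty) (t (ω i)) := fun i => hρ _ (hFQ ty) _ <|
            (hP.1 _).lt_of_ne' fun h => hpos.ne' (Finset.prod_eq_zero (Finset.mem_univ i) h)
          have h2 : ∏ i, ρ (F ty) (t (ω i)) < Real.exp (τ' * n) :=
            not_le.1 fun h => hω ⟨ty, h⟩
          rw [← Real.log_prod fun i _ => (h1 i).ne', mul_comm]
          exact (Real.log_lt_iff_lt_exp (Finset.prod_pos fun i _ => h1 i)).2 h2
      · refine neg_le_neg (mul_le_mul_of_nonneg_right ?_ n.cast_nonneg)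
        have := mul_le_mul_of_nonneg_left hlK hl0.le
        linarith
    calc ∑ ω : Fin n → Ω, (∏ i, mix κ q (ω i)) * Θᶜ.indicator 1 (fun i => t (ω i))
        ≤ ∑ ω : Fin n → Ω, (2 * ∑ ty, ∏ i, mix κ (F ty) (ω i)) *
            Θᶜ.indicator 1 (fun i => t (ω i)) :=
          Finset.sum_le_sum fun ω _ => mul_le_mul_of_nonneg_right (prod_mix_le hκ (hF q hq) ω)
            (Set.indicator_nonneg (fun _ _ => zero_le_one) _)
      _ = 2 * ∑ ty, ∑ ω : Fin n → Ω, (∏ i, mix κ (F ty) (ω i)) *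
            Θᶜ.indicator 1 (fun i => t (ω i)) := by
          rw [Finset.sum_comm, Finset.mul_sum]
          exact Finset.sum_congr rfl fun ω _ => by rw [mul_assoc, Finset.sum_mul]
      _ ≤ 2 * ∑ _ty : S → Fin (n + 1), Real.exp (-(l * δ / 2 * n)) :=
          mul_le_mul_of_nonneg_left (Finset.sum_le_sum fun ty _ => hmiss ty) zero_le_two
      _ ≤ Real.exp (-(l * δ / 4 * n)) := by
          rw [Finset.sum_const, Finset.card_univ, nsmul_eq_mul, hcard, ← mul_assoc]
          exact hN₁ n ((le_max_left _ _).trans hn)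
  · intro A _ w hw g hg
    set Θ : Set (Fin n → T) := {x | ∃ ty, Real.exp (τ' * n) ≤ ∏ i, ρ (F ty) (x i)} with hΘ
    have hind : ∀ x : Fin n → T, Θ.indicator (1 : (Fin n → T) → ℝ) x ≤
        ∑ ty, Real.exp (-(τ' * n)) * ∏ i, ρ (F ty) (x i) := by
      intro x
      have hnn : ∀ ty, 0 ≤ Real.exp (-(τ' * n)) * ∏ i, ρ (F ty) (x i) := fun ty =>
        mul_nonneg (Real.exp_pos _).le (Finset.prod_nonneg fun i _ => hρ0 _ (hFQ ty) _)
      by_cases hx : x ∈ Θ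
      · obtain ⟨ty, hty⟩ := hx
        rw [Set.indicator_of_mem (show x ∈ Θ from ⟨ty, hty⟩)]
        refine le_trans ?_ (Finset.single_le_sum (fun ty _ => hnn ty) (Finset.mem_univ ty))
        have := mul_le_mul_of_nonneg_left hty (Real.exp_pos (-(τ' * n))).le
        rwa [← Real.exp_add, neg_add_cancel, Real.exp_zero] at this
      · rw [Set.indicator_of_notMem hx]
        exact Finset.sum_nonneg fun ty _ => hnn ty
    calc ∑ α : Fin n → A, (∏ i, w (α i)) * Θ.indicator 1 (fun i => g i (α i))
        ≤ ∑ α : Fin n → A, (∏ i, w (α i)) *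
            ∑ ty, Real.exp (-(τ' * n)) * ∏ i, ρ (F ty) (g i (α i)) :=
          Finset.sum_le_sum fun α _ => mul_le_mul_of_nonneg_left (hind _)
            (Finset.prod_nonneg fun i _ => hw _)
      _ = ∑ ty, Real.exp (-(τ' * n)) * ∏ i, ∑ α, w α * ρ (F ty) (g i α) := by
          simp only [Finset.mul_sum]
          rw [Finset.sum_comm]
          refine Finset.sum_congr rfl fun ty _ => ?_
          rw [← sum_prod_eq_prod_sum fun i α => w α * ρ (F ty) (g i α), Finset.mul_sum]
          refine Finset.sum_congr rfl fun α _ => ?_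
          rw [Finset.prod_mul_distrib]
          ring
      _ ≤ ∑ _ty : S → Fin (n + 1), Real.exp (-(τ' * n)) := by
          refine Finset.sum_le_sum fun ty _ => mul_le_of_le_one_right (Real.exp_pos _).le ?_
          exact Finset.prod_le_one (fun i _ => Finset.sum_nonneg fun α _ =>
            mul_nonneg (hw α) (hρ0 _ (hFQ ty) _)) fun i _ => hg _ (hFQ ty) i
      _ ≤ Real.exp (-(τ * n)) := by
          rw [Finset.sum_const, Finset.card_univ, nsmul_eq_mul, hcard]
          simpa using hN₂ n ((le_max_right _ _).trans hn)

end UniversalTest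

/-! ### Universal tests for conditional mutual information -/

section ConditionalTest

universe v

variable {S Ω B C D : Type*} [Fintype S] [Fintype Ω]

lemma densityRatio_nonneg {p : Ω → ℝ} (hp : ∀ a, 0 ≤ p a) (f : Ω → B) (g : Ω → C) (h : Ω → D)
    (x : B × C × D) : 0 ≤ densityRatio p f g h x :=
  div_nonneg (mul_nonneg (law_nonneg hp _ _) (law_nonneg hp _ _))
    (mul_nonneg (law_nonneg hp _ _) (law_nonneg hp _ _))

/-- On the support, the density ratio is at least the joint probability and at most the inverse of
the joint probability of the first and third variable. -/
lemma densityRatio_bounds [Fintype C] [Fintype D] {p : Ω → ℝ} (hp : p ∈ stdSimplex ℝ Ω)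
    (f : Ω → B) (g : Ω → C) (h : Ω → D) {x : B × C × D}
    (hx : 0 < law p (fun a => (f a, g a, h a)) x) :
    law p (fun a => (f a, g a, h a)) x ≤ densityRatio p f g h x ∧
      densityRatio p f g h x ≤ (law p (fun a => (f a, h a)) (x.1, x.2.2))⁻¹ := by
  have h1 := law_comp_le hp.1 (fun a => (f a, g a, h a)) (fun x => (x.1, x.2.2)) x
  have h2 := law_comp_le hp.1 (fun a => (f a, g a, h a)) (fun x => x.2) x
  have h3 := law_comp_le hp.1 (fun a => (f a, h a)) (fun x => x.2) (x.1, x.2.2)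
  have h4 := law_le_one hp (fun a => (g a, h a)) x.2
  have h5 := law_comp_le hp.1 (fun a => (g a, h a)) (fun x => x.2) x.2
  dsimp only at h1 h2 h3 h5
  rw [densityRatio]
  set w := law p (fun a => (f a, g a, h a)) x
  set fh := law p (fun a => (f a, h a)) (x.1, x.2.2)
  set gh := law p (fun a => (g a, h a)) x.2
  set hh := law p h x.2.2
  have hfh : 0 < fh := hx.trans_le h1
  have hgh : 0 < gh := hx.trans_le h2
  have hhh : 0 < hh := hfh.trans_le h3
  have h6 := law_le_one hp h x.2.2
  constructor
  · rw [le_div_iff₀ (by positivity)]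
    refine mul_le_mul_of_nonneg_left ?_ hx.le
    nlinarith
  · rw [div_le_iff₀ (by positivity), inv_mul_cancel_left₀ hfh.ne']
    nlinarith

lemma sq_mul_exp_le {L : ℝ} (hL : L ≤ 0) : L ^ 2 * Real.exp (L / 2) ≤ 16 := by
  have h1 : -L / 4 ≤ Real.exp (-L / 4) := by linarith [Real.add_one_le_exp (-L / 4)]
  have h2 : (-L / 4) ^ 2 ≤ Real.exp (-L / 4) ^ 2 := pow_le_pow_left₀ (by linarith) h1 2
  have h3 : Real.exp (-L / 4) ^ 2 * Real.exp (L / 2) = 1 := by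
    rw [← Real.exp_nat_mul, ← Real.exp_add, Real.exp_eq_one_iff]
    push_cast
    ring
  have h4 := mul_le_mul_of_nonneg_right h2 (Real.exp_pos (L / 2)).le
  rw [h3] at h4
  nlinarith

/-- The weighted second moment of the information density is bounded in terms of the joint law of
the first and third variable only. -/
lemma second_moment_le [Fintype B] [Fintype C] [Fintype D] {p : Ω → ℝ}
    (hp : p ∈ stdSimplex ℝ Ω) (f : Ω → B) (g : Ω → C) (h : Ω → D) :
    ∑ ω, p ω * (Real.log (densityRatio p f g h (f ω, g ω, h ω)) ^ 2 *
      max 1 (Real.exp (-Real.log (densityRatio p f g h (f ω, g ω, h ω)) / 2))) ≤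
    ∑ x : B × C × D, (16 + Real.log (law p (fun a => (f a, h a)) (x.1, x.2.2)) ^ 2) := by
  rw [← sum_law_mul p (fun a => (f a, g a, h a)) fun x =>
    Real.log (densityRatio p f g h x) ^ 2 *
      max 1 (Real.exp (-Real.log (densityRatio p f g h x) / 2))]
  refine Finset.sum_le_sum fun x _ => ?_
  rcases (law_nonneg hp.1 (fun a => (f a, g a, h a)) x).eq_or_lt with h0 | hpos
  · rw [← h0, zero_mul]
    positivity
  obtain ⟨hlo, hhi⟩ := densityRatio_bounds hp f g h hpos
  have h1 := law_comp_le hp.1 (fun a => (f a, g a, h a)) (fun x => (x.1, x.2.2)) x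
  have h4 := law_le_one hp (fun a => (f a, g a, h a)) x
  dsimp only at h1
  set w := law p (fun a => (f a, g a, h a)) x
  set fh := law p (fun a => (f a, h a)) (x.1, x.2.2)
  set r := densityRatio p f g h x
  have hr : 0 < r := hpos.trans_le hlo
  have hz1 : Real.log w ≤ Real.log r := Real.log_le_log hpos hlo
  have hz2 : Real.log r ≤ -Real.log fh := by
    rw [← Real.log_inv]
    exact Real.log_le_log hr hhi
  have hw : Real.log w ≤ 0 := Real.log_nonpos hpos.le h4
  set z := Real.log r
  set L := Real.log w with hL
  have hzsq : z ^ 2 ≤ L ^ 2 + Real.log fh ^ 2 := by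
    rcases le_total 0 z with hz | hz <;> nlinarith [sq_nonneg L, sq_nonneg (Real.log fh)]
  have hmax : max 1 (Real.exp (-z / 2)) ≤ Real.exp (-L / 2) :=
    max_le (Real.one_le_exp (by linarith)) (Real.exp_le_exp.2 (by linarith))
  have hwe : w = Real.exp L := (Real.exp_log hpos).symm
  calc w * (z ^ 2 * max 1 (Real.exp (-z / 2)))
      ≤ w * ((L ^ 2 + Real.log fh ^ 2) * Real.exp (-L / 2)) :=
        mul_le_mul_of_nonneg_left (mul_le_mul hzsq hmax (by positivity) (by positivity)) hpos.le
    _ = L ^ 2 * Real.exp (L / 2) + Real.log fh ^ 2 * Real.exp (L / 2) := by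
        rw [hwe]
        have : Real.exp L * Real.exp (-L / 2) = Real.exp (L / 2) := by
          rw [← Real.exp_add]
          congr 1
          ring
        linear_combination (L ^ 2 + Real.log fh ^ 2) * this
    _ ≤ 16 + Real.log fh ^ 2 * 1 :=
        add_le_add (sq_mul_exp_le hw) (mul_le_mul_of_nonneg_left
          (Real.exp_le_one_iff.2 (by linarith)) (sq_nonneg _))
    _ = _ := by rw [mul_one]

/-- Averaged over the conditional law of the first variable given the third, the density ratio has
mean at most one. -/
lemma sum_mul_densityRatio_le_one [Fintype B] {p : Ω → ℝ} (hp : ∀ a, 0 ≤ p a) (f : Ω → B)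
    (g : Ω → C) (h : Ω → D) (v : B → ℝ) (c : C) (d : D)
    (hv : ∀ b, v b * law p h d = law p (fun a => (f a, h a)) (b, d)) :
    ∑ b, v b * densityRatio p f g h (b, c, d) ≤ 1 := by
  have hterm : ∀ b, v b * densityRatio p f g h (b, c, d) ≤
      law p (fun a => (f a, g a, h a)) (b, c, d) / law p (fun a => (g a, h a)) (c, d) := by
    intro b
    have h0 := law_nonneg hp (fun a => (f a, g a, h a)) (b, c, d)
    have h1 := law_nonneg hp (fun a => (g a, h a)) (c, d)
    simp only [densityRatio]
    rw [mul_comm (law p (fun a => (f a, g a, h a)) (b, c, d)), ← mul_div_assoc, ← mul_assoc, hv b]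
    rcases eq_or_ne (law p (fun a => (f a, h a)) (b, d)) 0 with hz | hz
    · rw [hz]
      simpa using div_nonneg h0 h1
    · rw [mul_div_mul_left _ _ hz]
  refine (Finset.sum_le_sum fun b _ => hterm b).trans ?_
  rw [← Finset.sum_div, sum_law_pair_left p f (fun a => (g a, h a))]
  exact div_self_le_one _

lemma law_mix (κ : S → Ω → ℝ) (q : S → ℝ) (f : Ω → B) (b : B) :
    law (mix κ q) f b = ∑ s, q s * law (κ s) f b := by
  classical
  simp only [law, mix, Finset.mul_sum]
  rw [Finset.sum_comm]
  refine Finset.sum_congr rfl fun ω _ => ?_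
  split_ifs <;> simp

/-- Universal test for a conditional mutual information: the observed triple is `(f, g, h)`, and a
competitor's letter is drawn from the conditional law of `f` given `h`, which must not depend on the
state. Mutual informations are in bits but the exponent `τ` is in nats. -/
theorem exists_conditional_test [Fintype B] [Fintype C] [Fintype D] {κ : S → Ω → ℝ}
    (hκ : ∀ s, κ s ∈ stdSimplex ℝ Ω)
    {Q : Set (S → ℝ)} (hQ : Q ⊆ stdSimplex ℝ S) (hQne : Q.Nonempty)
    (f : Ω → B) (g : Ω → C) (h : Ω → D) (π : B × D → ℝ)
    (hπ : ∀ s, law (κ s) (fun ω => (f ω, h ω)) = π) {I τ : ℝ}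
    (hI : ∀ q ∈ Q, I ≤ condMutualInfo (mix κ q) f g h) (hτ : τ < I * Real.log 2) :
    ∃ a : ℝ, 0 < a ∧ ∃ N : ℕ, ∀ n ≥ N, ∃ Θ : Set (Fin n → B × C × D),
      (∀ q ∈ Q, ∑ ω : Fin n → Ω, (∏ i, mix κ q (ω i)) *
        Θᶜ.indicator 1 (fun i => (f (ω i), g (ω i), h (ω i))) ≤ Real.exp (-(a * n))) ∧
      ∀ {A : Type v} [Fintype A] (w : A → ℝ) (_ : ∀ α, 0 ≤ w α) (x : D → A → B)
        (_ : ∀ d b, law w (x d) b * ∑ b', π (b', d) = π (b, d)) (y : Fin n → C) (d : Fin n → D),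
        ∑ α : Fin n → A, (∏ i, w (α i)) * Θ.indicator 1 (fun i => (x (d i) (α i), y i, d i)) ≤
          Real.exp (-(τ * n)) := by
  have hm : ∀ q ∈ Q, mix κ q ∈ stdSimplex ℝ Ω := fun q hq => mix_mem hκ (hQ hq)
  have hlaw : ∀ q ∈ Q, ∀ x, law (mix κ q) (fun ω => (f ω, h ω)) x = π x := by
    intro q hq x
    rw [law_mix]
    simp only [hπ, ← Finset.sum_mul, (hQ hq).2, one_mul]
  have hl2 : 0 < Real.log 2 := Real.log_pos one_lt_two
  obtain ⟨a, ha, N, hN⟩ := exists_universal_test.{v} hκ (fun ω => (f ω, g ω, h ω)) hQ hQne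
    (fun q => densityRatio (mix κ q) f g h)
    (fun q hq x => densityRatio_nonneg (hm q hq).1 f g h x)
    (fun q hq ω hω => by
      have : 0 < law (mix κ q) (fun ω => (f ω, g ω, h ω)) (f ω, g ω, h ω) :=
        hω.trans_le (le_law (hm q hq).1 _ _)
      exact this.trans_le (densityRatio_bounds (hm q hq) f g h this).1)
    (I := I * Real.log 2) (K := ∑ x : B × C × D, (16 + Real.log (π (x.1, x.2.2)) ^ 2))
    (fun q hq => by
      refine (mul_le_mul_of_nonneg_right (hI q hq) hl2.le).trans (le_of_eq ?_)
      rw [condMutualInfo_eq_sum, Finset.sum_mul]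
      refine Finset.sum_congr rfl fun ω _ => ?_
      rw [Real.logb, mul_assoc, div_mul_cancel₀ _ hl2.ne'])
    (fun q hq => by
      refine (second_moment_le (hm q hq) f g h).trans (le_of_eq ?_)
      simp only [hlaw q hq]) hτ
  refine ⟨a, ha, N, fun n hn => ?_⟩
  obtain ⟨Θ, hmiss, hfa⟩ := hN n hn
  refine ⟨Θ, hmiss, fun {A} _ w hw x hx y d => ?_⟩
  refine hfa w hw (fun i α => (x (d i) α, y i, d i)) fun q hq i => ?_
  rw [← sum_law_mul w (x (d i)) fun b => densityRatio (mix κ q) f g h (b, y i, d i)]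
  refine sum_mul_densityRatio_le_one (hm q hq).1 f g h _ _ _ fun b => ?_
  rw [hlaw q hq, ← sum_law_pair_left (mix κ q) f h]
  simp only [hlaw q hq, hx]

end ConditionalTest

/-! ### The superposition ensemble -/

section Ensemble

variable {U V Z : Type*} [Fintype U] [Fintype V] [Fintype Z] {n M₁ M₂ : ℕ}

lemma sum_mul_le_of_forall_le {A : Type*} [Fintype A] {w F : A → ℝ} {β : ℝ}
    (hw : w ∈ stdSimplex ℝ A) (h : ∀ a, F a ≤ β) : ∑ a, w a * F a ≤ β := by
  refine (Finset.sum_le_sum fun a _ => mul_le_mul_of_nonneg_left (h a) (hw.1 a)).trans (le_of_eq ?_)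
  rw [← Finset.sum_mul, hw.2, one_mul]

lemma prod_mem_stdSimplex {ι A : Type*} [Fintype ι] [DecidableEq ι] [Fintype A] {w : ι → A → ℝ}
    (hw : ∀ i, w i ∈ stdSimplex ℝ A) :
    (fun c : ι → A => ∏ i, w i (c i)) ∈ stdSimplex ℝ (ι → A) :=
  ⟨fun c => Finset.prod_nonneg fun i _ => (hw i).1 (c i), sum_prod_eq_one fun i => (hw i).2⟩

/-- The pmf of a codebook with `M₁` independent words whose letters are i.i.d. with pmf `p`. -/
noncomputable def codebookWeight (p : U → ℝ) (c : Fin M₁ → Fin n → U) : ℝ :=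
  ∏ a, ∏ i, p (c a i)

lemma codebookWeight_mem {p : U → ℝ} (hp : p ∈ stdSimplex ℝ U) :
    (codebookWeight p : (Fin M₁ → Fin n → U) → ℝ) ∈ stdSimplex ℝ (Fin M₁ → Fin n → U) :=
  prod_mem_stdSimplex (w := fun _ (u : Fin n → U) => ∏ i, p (u i)) fun _ =>
    prod_mem_stdSimplex fun _ => hp

/-- The joint pmf of two independent random codebooks and the channel output when the words with
indices `a` and `b` are combined and sent over the memoryless channel `k`. -/
noncomputable def ensembleWeight (pU : U → ℝ) (pV : V → ℝ) (k : U → V → Z → ℝ) (a : Fin M₁)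
    (b : Fin M₂) (ξ : (Fin M₁ → Fin n → U) × (Fin M₂ → Fin n → V) × (Fin n → Z)) : ℝ :=
  codebookWeight pU ξ.1 * (codebookWeight pV ξ.2.1 * ∏ i, k (ξ.1 a i) (ξ.2.1 b i) (ξ.2.2 i))

variable {pU : U → ℝ} {pV : V → ℝ} {k : U → V → Z → ℝ}

/-- The transmitted words and the output are distributed as an i.i.d. sequence. -/
lemma sum_ensembleWeight_mul (hU : pU ∈ stdSimplex ℝ U) (hV : pV ∈ stdSimplex ℝ V)
    (a : Fin M₁) (b : Fin M₂) (G : (Fin n → U) → (Fin n → V) → (Fin n → Z) → ℝ) :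
    ∑ ξ, ensembleWeight pU pV k a b ξ * G (ξ.1 a) (ξ.2.1 b) ξ.2.2 =
      ∑ ω : Fin n → U × V × Z, (∏ i, pU (ω i).1 * (pV (ω i).2.1 *
        k (ω i).1 (ω i).2.1 (ω i).2.2)) *
        G (fun i => (ω i).1) (fun i => (ω i).2.1) fun i => (ω i).2.2 := by
  have hU' := (prod_mem_stdSimplex (ι := Fin n) fun _ => hU).2
  have hV' := (prod_mem_stdSimplex (ι := Fin n) fun _ => hV).2
  have h1 : ∑ ξ, ensembleWeight pU pV k a b ξ * G (ξ.1 a) (ξ.2.1 b) ξ.2.2 =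
      ∑ u : Fin n → U, (∏ i, pU (u i)) * ∑ v : Fin n → V, (∏ i, pV (v i)) *
        ∑ z : Fin n → Z, (∏ i, k (u i) (v i) (z i)) * G u v z := by
    rw [Fintype.sum_prod_type, ← sum_prod_mul_apply (w := fun (_ : Fin M₁) (u : Fin n → U) =>
      ∏ i, pU (u i)) (fun _ => hU') a fun u => ∑ v : Fin n → V, (∏ i, pV (v i)) *
        ∑ z : Fin n → Z, (∏ i, k (u i) (v i) (z i)) * G u v z]
    refine Finset.sum_congr rfl fun c₁ _ => ?_
    rw [Fintype.sum_prod_type, ← sum_prod_mul_apply (w := fun (_ : Fin M₂) (v : Fin n → V) =>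
      ∏ i, pV (v i)) (fun _ => hV') b fun v =>
        ∑ z : Fin n → Z, (∏ i, k (c₁ a i) (v i) (z i)) * G (c₁ a) v z, Finset.mul_sum]
    refine Finset.sum_congr rfl fun c₂ _ => ?_
    simp only [ensembleWeight, codebookWeight, Finset.mul_sum]
    exact Finset.sum_congr rfl fun z _ => by ring
  rw [h1]
  simp only [Finset.mul_sum]
  rw [← Fintype.sum_equiv ((Equiv.arrowProdEquivProdArrow (Fin n) (fun _ => U) fun _ => V × Z).trans
    (Equiv.prodCongr (Equiv.refl _)
      (Equiv.arrowProdEquivProdArrow (Fin n) (fun _ => V) fun _ => Z))).symm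
    (fun x : (Fin n → U) × (Fin n → V) × (Fin n → Z) => (∏ i, pU (x.1 i)) * ((∏ i, pV (x.2.1 i)) *
      ((∏ i, k (x.1 i) (x.2.1 i) (x.2.2 i)) * G x.1 x.2.1 x.2.2))) _ (fun x => ?_)]
  · rw [Fintype.sum_prod_type]
    exact Finset.sum_congr rfl fun u _ => by rw [Fintype.sum_prod_type]
  · simp only [Finset.prod_mul_distrib]
    simp [Equiv.arrowProdEquivProdArrow]
    ring

/-- A word of the first codebook that was not sent is independent of the output. -/
lemma sum_ensembleWeight_mul_le_left (hU : pU ∈ stdSimplex ℝ U) (hV : pV ∈ stdSimplex ℝ V)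
    (hk : ∀ u v, k u v ∈ stdSimplex ℝ Z) {a a' : Fin M₁} (b : Fin M₂) (ha : a ≠ a')
    (G : (Fin n → U) → (Fin n → Z) → ℝ) {β : ℝ}
    (hG : ∀ z, ∑ u : Fin n → U, (∏ i, pU (u i)) * G u z ≤ β) :
    ∑ ξ, ensembleWeight pU pV k a b ξ * G (ξ.1 a') ξ.2.2 ≤ β := by
  have hU' := prod_mem_stdSimplex (ι := Fin n) fun _ => hU
  have h1 : ∑ ξ, ensembleWeight pU pV k a b ξ * G (ξ.1 a') ξ.2.2 =
      ∑ c₂ : Fin M₂ → Fin n → V, codebookWeight pV c₂ * ∑ c₁ : Fin M₁ → Fin n → U,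
        codebookWeight pU c₁ * ∑ z : Fin n → Z, (∏ i, k (c₁ a i) (c₂ b i) (z i)) * G (c₁ a') z := by
    simp only [Fintype.sum_prod_type, ensembleWeight, Finset.mul_sum]
    rw [Finset.sum_comm]
    exact Finset.sum_congr rfl fun c₂ _ => Finset.sum_congr rfl fun c₁ _ =>
      Finset.sum_congr rfl fun z _ => by ring
  rw [h1]
  refine sum_mul_le_of_forall_le (codebookWeight_mem hV) fun c₂ => ?_
  have h2 := sum_prod_mul_apply₂ hU'.2 ha fun u u' =>
    ∑ z : Fin n → Z, (∏ i, k (u i) (c₂ b i) (z i)) * G u' z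
  refine (le_of_eq h2).trans (sum_mul_le_of_forall_le hU' fun u => ?_)
  simp only [Finset.mul_sum]
  rw [Finset.sum_comm]
  refine le_trans (le_of_eq ?_) (sum_mul_le_of_forall_le
    (prod_mem_stdSimplex fun i => hk (u i) (c₂ b i)) hG)
  simp only [Finset.mul_sum]
  exact Finset.sum_congr rfl fun z _ => Finset.sum_congr rfl fun u' _ => by ring

/-- A word of the second codebook that was not sent is independent of the output and of the word of
the first codebook that was sent. -/
lemma sum_ensembleWeight_mul_le_right (hU : pU ∈ stdSimplex ℝ U) (hV : pV ∈ stdSimplex ℝ V)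
    (hk : ∀ u v, k u v ∈ stdSimplex ℝ Z) (a : Fin M₁) {b b' : Fin M₂} (hb : b ≠ b')
    (G : (Fin n → U) → (Fin n → V) → (Fin n → Z) → ℝ) {β : ℝ}
    (hG : ∀ u z, ∑ v : Fin n → V, (∏ i, pV (v i)) * G u v z ≤ β) :
    ∑ ξ, ensembleWeight pU pV k a b ξ * G (ξ.1 a) (ξ.2.1 b') ξ.2.2 ≤ β := by
  have hV' := prod_mem_stdSimplex (ι := Fin n) fun _ => hV
  have h1 : ∑ ξ, ensembleWeight pU pV k a b ξ * G (ξ.1 a) (ξ.2.1 b') ξ.2.2 =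
      ∑ c₁ : Fin M₁ → Fin n → U, codebookWeight pU c₁ * ∑ c₂ : Fin M₂ → Fin n → V,
        codebookWeight pV c₂ *
          ∑ z : Fin n → Z, (∏ i, k (c₁ a i) (c₂ b i) (z i)) * G (c₁ a) (c₂ b') z := by
    simp only [Fintype.sum_prod_type, ensembleWeight, Finset.mul_sum]
    exact Finset.sum_congr rfl fun c₁ _ => Finset.sum_congr rfl fun c₂ _ =>
      Finset.sum_congr rfl fun z _ => by ring
  rw [h1]
  refine sum_mul_le_of_forall_le (codebookWeight_mem hU) fun c₁ => ?_
  have h2 := sum_prod_mul_apply₂ hV'.2 hb fun v v' =>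
    ∑ z : Fin n → Z, (∏ i, k (c₁ a i) (v i) (z i)) * G (c₁ a) v' z
  refine (le_of_eq h2).trans (sum_mul_le_of_forall_le hV' fun v => ?_)
  simp only [Finset.mul_sum]
  rw [Finset.sum_comm]
  refine le_trans (le_of_eq ?_) (sum_mul_le_of_forall_le
    (prod_mem_stdSimplex fun i => hk (c₁ a i) (v i)) (hG (c₁ a)))
  simp only [Finset.mul_sum]
  exact Finset.sum_congr rfl fun z _ => Finset.sum_congr rfl fun v' _ => by ring

end Ensemble

/-! ### Partial decode-forward codes -/

lemma epsilon_eq_of_forall {α : Type*} [Nonempty α] {p : α → Prop} {a : α} (ha : p a)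
    (h : ∀ a', a' ≠ a → ¬ p a') : Classical.epsilon p = a := by
  by_contra hne
  exact h _ hne (Classical.epsilon_spec ⟨a, ha⟩)

lemma indicator_one_nonneg {α : Type*} (s : Set α) (x : α) : 0 ≤ s.indicator (1 : α → ℝ) x :=
  Set.indicator_nonneg (fun _ _ => zero_le_one) _

lemma indicator_one_of_mem {α : Type*} {s : Set α} {x : α} (h : x ∈ s) :
    s.indicator (1 : α → ℝ) x = 1 :=
  Set.indicator_of_mem h _

section SuperpositionCode

variable {U X Y Y₁ : Type*} {n M M₁ M₂ L : ℕ}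

/-- The partial decode-forward code of a pair of codebooks. Messages are embedded by `e` into pairs
`(a, b)`; `c₁ a` is a word over `U`, and `c₂ b` is a word of maps `U → X`, the channel input being
`c₂ b` applied letterwise to `c₁ a`. The relay decodes `a` with the test `Θ₁` and forwards its bin;
the receiver decodes `a` within the bin with `Θ₂` and then `b` with `Θ₃`. Where a test accepts
several indices or none, `Classical.epsilon` picks an arbitrary one. -/
noncomputable def superpositionCode [Nonempty (Fin M)] [Nonempty (Fin M₁)] [Nonempty (Fin M₂)]
    (e : Fin M → Fin M₁ × Fin M₂) (bin : Fin M₁ → Fin L) (Θ₁ : Set (Fin n → U × Y₁ × Unit))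
    (Θ₂ : Set (Fin n → U × Y × Unit)) (Θ₃ : Set (Fin n → X × Y × U)) (c₁ : Fin M₁ → Fin n → U)
    (c₂ : Fin M₂ → Fin n → U → X) : RelayCode X Y Y₁ n M L where
  enc m i := c₂ (e m).2 i (c₁ (e m).1 i)
  relay y₁ := bin (Classical.epsilon fun a => (fun i => (c₁ a i, y₁ i, ())) ∈ Θ₁)
  dec y ℓ := Function.invFun e
    (Classical.epsilon fun a => bin a = ℓ ∧ (fun i => (c₁ a i, y i, ())) ∈ Θ₂,
     Classical.epsilon fun b =>
      (fun i => (c₂ b i (c₁ (Classical.epsilon fun a =>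
          bin a = ℓ ∧ (fun i => (c₁ a i, y i, ())) ∈ Θ₂) i), y i,
        c₁ (Classical.epsilon fun a => bin a = ℓ ∧ (fun i => (c₁ a i, y i, ())) ∈ Θ₂) i)) ∈ Θ₃)

variable [Nonempty (Fin M)] [Nonempty (Fin M₁)] [Nonempty (Fin M₂)]

lemma superpositionCode_dec_eq {e : Fin M → Fin M₁ × Fin M₂} (he : Function.Injective e)
    (bin : Fin M₁ → Fin L)
    (Θ₁ : Set (Fin n → U × Y₁ × Unit)) (Θ₂ : Set (Fin n → U × Y × Unit))
    (Θ₃ : Set (Fin n → X × Y × U)) (c₁ : Fin M₁ → Fin n → U) (c₂ : Fin M₂ → Fin n → U → X)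
    (m : Fin M) (y : Fin n → Y) (y₁ : Fin n → Y₁)
    (h₁ : (fun i => (c₁ (e m).1 i, y₁ i, ())) ∈ Θ₁)
    (h₁' : ∀ a, a ≠ (e m).1 → (fun i => (c₁ a i, y₁ i, ())) ∉ Θ₁)
    (h₂ : (fun i => (c₁ (e m).1 i, y i, ())) ∈ Θ₂)
    (h₂' : ∀ a, a ≠ (e m).1 → bin a = bin (e m).1 → (fun i => (c₁ a i, y i, ())) ∉ Θ₂)
    (h₃ : (fun i => (c₂ (e m).2 i (c₁ (e m).1 i), y i, c₁ (e m).1 i)) ∈ Θ₃)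
    (h₃' : ∀ b, b ≠ (e m).2 → (fun i => (c₂ b i (c₁ (e m).1 i), y i, c₁ (e m).1 i)) ∉ Θ₃) :
    (superpositionCode e bin Θ₁ Θ₂ Θ₃ c₁ c₂).dec y
      ((superpositionCode e bin Θ₁ Θ₂ Θ₃ c₁ c₂).relay y₁) = m := by
  have e1 := epsilon_eq_of_forall (p := fun a => (fun i => (c₁ a i, y₁ i, ())) ∈ Θ₁) h₁ h₁'
  have e2 := epsilon_eq_of_forall
    (p := fun a => bin a = bin (e m).1 ∧ (fun i => (c₁ a i, y i, ())) ∈ Θ₂) ⟨rfl, h₂⟩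
    fun a ha h => h₂' a ha h.1 h.2
  have e3 := epsilon_eq_of_forall
    (p := fun b => (fun i => (c₂ b i (c₁ (e m).1 i), y i, c₁ (e m).1 i)) ∈ Θ₃) h₃ h₃'
  simp only [superpositionCode, e1, e2, e3]
  exact Function.leftInverse_invFun he m

open Classical in
/-- The union bound for the six ways in which decoding can fail. -/
lemma superpositionCode_error_le {e : Fin M → Fin M₁ × Fin M₂} (he : Function.Injective e)
    (bin : Fin M₁ → Fin L)
    (Θ₁ : Set (Fin n → U × Y₁ × Unit)) (Θ₂ : Set (Fin n → U × Y × Unit))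
    (Θ₃ : Set (Fin n → X × Y × U)) (c₁ : Fin M₁ → Fin n → U) (c₂ : Fin M₂ → Fin n → U → X)
    (m : Fin M) (y : Fin n → Y) (y₁ : Fin n → Y₁) :
    (if (superpositionCode e bin Θ₁ Θ₂ Θ₃ c₁ c₂).dec y
      ((superpositionCode e bin Θ₁ Θ₂ Θ₃ c₁ c₂).relay y₁) ≠ m then (1 : ℝ) else 0) ≤
    Θ₁ᶜ.indicator 1 (fun i => (c₁ (e m).1 i, y₁ i, ())) +
    (∑ a ∈ Finset.univ.erase (e m).1, Θ₁.indicator 1 (fun i => (c₁ a i, y₁ i, ()))) +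
    Θ₂ᶜ.indicator 1 (fun i => (c₁ (e m).1 i, y i, ())) +
    (∑ a ∈ (Finset.univ.erase (e m).1).filter fun a => bin a = bin (e m).1,
      Θ₂.indicator 1 (fun i => (c₁ a i, y i, ()))) +
    Θ₃ᶜ.indicator 1 (fun i => (c₂ (e m).2 i (c₁ (e m).1 i), y i, c₁ (e m).1 i)) +
    ∑ b ∈ Finset.univ.erase (e m).2,
      Θ₃.indicator 1 (fun i => (c₂ b i (c₁ (e m).1 i), y i, c₁ (e m).1 i)) := by
  have n1 := indicator_one_nonneg Θ₁ᶜ (fun i => (c₁ (e m).1 i, y₁ i, ()))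
  have n2 := Finset.sum_nonneg fun a (_ : a ∈ Finset.univ.erase (e m).1) =>
    indicator_one_nonneg Θ₁ (fun i => (c₁ a i, y₁ i, ()))
  have n3 := indicator_one_nonneg Θ₂ᶜ (fun i => (c₁ (e m).1 i, y i, ()))
  have n4 := Finset.sum_nonneg fun a
    (_ : a ∈ (Finset.univ.erase (e m).1).filter fun a => bin a = bin (e m).1) =>
    indicator_one_nonneg Θ₂ (fun i => (c₁ a i, y i, ()))
  have n5 := indicator_one_nonneg Θ₃ᶜ (fun i => (c₂ (e m).2 i (c₁ (e m).1 i), y i, c₁ (e m).1 i))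
  have n6 := Finset.sum_nonneg fun b (_ : b ∈ Finset.univ.erase (e m).2) =>
    indicator_one_nonneg Θ₃ (fun i => (c₂ b i (c₁ (e m).1 i), y i, c₁ (e m).1 i))
  split_ifs with hdec
  swap
  · linarith
  by_contra! hlt
  refine hdec (superpositionCode_dec_eq he bin Θ₁ Θ₂ Θ₃ c₁ c₂ m y y₁ ?_ ?_ ?_ ?_ ?_ ?_)
  · by_contra h
    have := indicator_one_of_mem (show _ ∈ Θ₁ᶜ from h)
    linarith
  · intro a ha h
    have := Finset.single_le_sum (fun a _ => indicator_one_nonneg Θ₁ (fun i => (c₁ a i, y₁ i, ())))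
      (Finset.mem_erase.2 ⟨ha, Finset.mem_univ a⟩)
    rw [indicator_one_of_mem h] at this
    linarith
  · by_contra h
    have := indicator_one_of_mem (show _ ∈ Θ₂ᶜ from h)
    linarith
  · intro a ha hb h
    have := Finset.single_le_sum (fun a _ => indicator_one_nonneg Θ₂ (fun i => (c₁ a i, y i, ())))
      ((Finset.mem_filter (p := fun a => bin a = bin (e m).1)).2
        ⟨Finset.mem_erase.2 ⟨ha, Finset.mem_univ a⟩, hb⟩)
    rw [indicator_one_of_mem h] at this
    linarith
  · by_contra h
    have := indicator_one_of_mem (show _ ∈ Θ₃ᶜ from h)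
    linarith
  · intro b hb h
    have := Finset.single_le_sum
      (fun b _ => indicator_one_nonneg Θ₃ (fun i => (c₂ b i (c₁ (e m).1 i), y i, c₁ (e m).1 i)))
      (Finset.mem_erase.2 ⟨hb, Finset.mem_univ b⟩)
    rw [indicator_one_of_mem h] at this
    linarith

end SuperpositionCode

namespace PrimitiveRelayChannel

variable {X S Y Y₁ U : Type*} [Fintype Y] [Fintype Y₁] (ch : PrimitiveRelayChannel X S Y Y₁)

/-- The joint law, given the state, of a letter `u`, an independent map `v : U → X`, and the output
of the channel with input `v u`. -/
noncomputable def strategyLaw (pU : U → ℝ) (pV : (U → X) → ℝ) (s : S)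
    (ω : U × (U → X) × (Y × Y₁)) : ℝ :=
  pU ω.1 * (pV ω.2.1 * ch.W (ω.2.1 ω.1) s ω.2.2)

variable {pU : U → ℝ} {pV : (U → X) → ℝ}

lemma mix_strategyLaw [Fintype S] (q : S → ℝ) (ω : U × (U → X) × (Y × Y₁)) :
    mix (ch.strategyLaw pU pV) q ω = pU ω.1 * (pV ω.2.1 * ch.avgW q (ω.2.1 ω.1) ω.2.2) := by
  simp only [mix, strategyLaw, avgW, Finset.mul_sum]
  exact Finset.sum_congr rfl fun s _ => by ring

variable [Fintype X] [Fintype U] [DecidableEq U]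

lemma strategyLaw_mem (hU : pU ∈ stdSimplex ℝ U) (hV : pV ∈ stdSimplex ℝ (U → X)) (s : S) :
    ch.strategyLaw pU pV s ∈ stdSimplex ℝ (U × (U → X) × (Y × Y₁)) := by
  refine ⟨fun ω => mul_nonneg (hU.1 _) (mul_nonneg (hV.1 _) ((ch.W_mem _ _).1 _)), ?_⟩
  rw [Fintype.sum_prod_type]
  simp only [strategyLaw, Fintype.sum_prod_type (f := fun x : (U → X) × (Y × Y₁) => _),
    ← Finset.mul_sum, (ch.W_mem _ _).2, mul_one, hV.2, hU.2]

variable [Fintype S]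
  {n M M₁ M₂ L : ℕ} [Nonempty (Fin M)] [Nonempty (Fin M₁)] [Nonempty (Fin M₂)]

/-- The expected error probability over the random superposition code at a single state pmf, in
terms of the miss and false-alarm probabilities of the tests. -/
lemma sum_codebookWeight_mul_err_le {q : S → ℝ} (hq : q ∈ stdSimplex ℝ S)
    (hU : pU ∈ stdSimplex ℝ U) (hV : pV ∈ stdSimplex ℝ (U → X))
    {e : Fin M → Fin M₁ × Fin M₂} (he : Function.Injective e) (bin : Fin M₁ → Fin L) {N₂ : ℕ}
    (hbin : ∀ a, ((Finset.univ.erase a).filter fun a' => bin a' = bin a).card ≤ N₂)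
    (Θ₁ : Set (Fin n → U × Y₁ × Unit)) (Θ₂ : Set (Fin n → U × Y × Unit))
    (Θ₃ : Set (Fin n → X × Y × U)) {η₁ η₂ η₃ β₁ β₂ β₃ : ℝ} (hβ₂ : 0 ≤ β₂)
    (hm₁ : ∑ ω : Fin n → U × (U → X) × (Y × Y₁), (∏ i, mix (ch.strategyLaw pU pV) q (ω i)) *
      Θ₁ᶜ.indicator 1 (fun i => ((ω i).1, (ω i).2.2.2, ())) ≤ η₁)
    (hm₂ : ∑ ω : Fin n → U × (U → X) × (Y × Y₁), (∏ i, mix (ch.strategyLaw pU pV) q (ω i)) *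
      Θ₂ᶜ.indicator 1 (fun i => ((ω i).1, (ω i).2.2.1, ())) ≤ η₂)
    (hm₃ : ∑ ω : Fin n → U × (U → X) × (Y × Y₁), (∏ i, mix (ch.strategyLaw pU pV) q (ω i)) *
      Θ₃ᶜ.indicator 1 (fun i => ((ω i).2.1 (ω i).1, (ω i).2.2.1, (ω i).1)) ≤ η₃)
    (hf₁ : ∀ y₁ : Fin n → Y₁, ∑ u : Fin n → U, (∏ i, pU (u i)) *
      Θ₁.indicator 1 (fun i => (u i, y₁ i, ())) ≤ β₁)
    (hf₂ : ∀ y : Fin n → Y, ∑ u : Fin n → U, (∏ i, pU (u i)) *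
      Θ₂.indicator 1 (fun i => (u i, y i, ())) ≤ β₂)
    (hf₃ : ∀ (u : Fin n → U) (y : Fin n → Y), ∑ v : Fin n → U → X, (∏ i, pV (v i)) *
      Θ₃.indicator 1 (fun i => (v i (u i), y i, u i)) ≤ β₃) :
    ∑ c : (Fin M₁ → Fin n → U) × (Fin M₂ → Fin n → U → X),
      (codebookWeight pU c.1 * codebookWeight pV c.2) *
        ch.err q (superpositionCode e bin Θ₁ Θ₂ Θ₃ c.1 c.2) ≤
      (η₁ + (M₁ - 1 : ℕ) * β₁ + η₂ + N₂ * β₂ + η₃ + (M₂ - 1 : ℕ) * β₃) := by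
  classical
  set B := η₁ + (M₁ - 1 : ℕ) * β₁ + η₂ + N₂ * β₂ + η₃ + (M₂ - 1 : ℕ) * β₃ with hB
  have hk : ∀ (u : U) (v : U → X), ch.avgW q (v u) ∈ stdSimplex ℝ (Y × Y₁) := fun u v =>
    ch.avgW_mem hq _
  set k : U → (U → X) → Y × Y₁ → ℝ := fun u v => ch.avgW q (v u) with hkdef
  have hmix : ∀ ω : Fin n → U × (U → X) × (Y × Y₁), ∏ i, mix (ch.strategyLaw pU pV) q (ω i) =
      ∏ i, pU (ω i).1 * (pV (ω i).2.1 * k (ω i).1 (ω i).2.1 (ω i).2.2) := fun ω =>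
    Finset.prod_congr rfl fun i _ => ch.mix_strategyLaw q _
  have hwpos : ∀ a b ξ, 0 ≤ ensembleWeight (n := n) (M₁ := M₁) (M₂ := M₂) pU pV k a b ξ :=
    fun a b ξ => mul_nonneg ((codebookWeight_mem hU).1 _) (mul_nonneg ((codebookWeight_mem hV).1 _)
      (Finset.prod_nonneg fun i _ => (hk _ _).1 _))
  have hmsg : ∀ m : Fin M, ∑ ξ : (Fin M₁ → Fin n → U) × (Fin M₂ → Fin n → U → X) ×
      (Fin n → Y × Y₁), ensembleWeight pU pV k (e m).1 (e m).2 ξ *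
        (if (superpositionCode e bin Θ₁ Θ₂ Θ₃ ξ.1 ξ.2.1).dec (fun i => (ξ.2.2 i).1)
          ((superpositionCode e bin Θ₁ Θ₂ Θ₃ ξ.1 ξ.2.1).relay fun i => (ξ.2.2 i).2) ≠ m
          then 1 else 0) ≤ B := by
    intro m
    refine (Finset.sum_le_sum fun ξ _ => mul_le_mul_of_nonneg_left
      (superpositionCode_error_le he bin Θ₁ Θ₂ Θ₃ ξ.1 ξ.2.1 m _ _) (hwpos _ _ ξ)).trans ?_
    simp only [mul_add, Finset.sum_add_distrib]
    refine add_le_add (add_le_add (add_le_add (add_le_add (add_le_add ?_ ?_) ?_) ?_) ?_) ?_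
    · refine le_trans (le_of_eq ?_) hm₁
      simp only [hmix]
      exact sum_ensembleWeight_mul hU hV _ _
        fun u _ (z : Fin n → Y × Y₁) => Θ₁ᶜ.indicator 1 fun i => (u i, (z i).2, ())
    · simp only [Finset.mul_sum]
      rw [Finset.sum_comm]
      refine (Finset.sum_le_card_nsmul _ _ β₁ fun a ha => ?_).trans (le_of_eq ?_)
      · exact sum_ensembleWeight_mul_le_left hU hV hk _ (Finset.ne_of_mem_erase ha).symm
          (fun u (z : Fin n → Y × Y₁) => Θ₁.indicator 1 fun i => (u i, (z i).2, ())) fun z => hf₁ _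
      · simp [Finset.card_erase_of_mem]
    · refine le_trans (le_of_eq ?_) hm₂
      simp only [hmix]
      exact sum_ensembleWeight_mul hU hV _ _
        fun u _ (z : Fin n → Y × Y₁) => Θ₂ᶜ.indicator 1 fun i => (u i, (z i).1, ())
    · simp only [Finset.mul_sum]
      rw [Finset.sum_comm]
      refine (Finset.sum_le_card_nsmul _ _ β₂ fun a ha => ?_).trans ?_
      · exact sum_ensembleWeight_mul_le_left hU hV hk _
          (Finset.ne_of_mem_erase (Finset.mem_filter.1 ha).1).symm
          (fun u (z : Fin n → Y × Y₁) => Θ₂.indicator 1 fun i => (u i, (z i).1, ())) fun z => hf₂ _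
      · rw [nsmul_eq_mul]
        exact mul_le_mul_of_nonneg_right (by exact_mod_cast hbin (e m).1) hβ₂
    · refine le_trans (le_of_eq ?_) hm₃
      simp only [hmix]
      exact sum_ensembleWeight_mul hU hV _ _
        fun u v (z : Fin n → Y × Y₁) => Θ₃ᶜ.indicator 1 fun i => (v i (u i), (z i).1, u i)
    · simp only [Finset.mul_sum]
      rw [Finset.sum_comm]
      refine (Finset.sum_le_card_nsmul _ _ β₃ fun b hb => ?_).trans (le_of_eq ?_)
      · exact sum_ensembleWeight_mul_le_right hU hV hk _ (Finset.ne_of_mem_erase hb).symm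
          (fun u v (z : Fin n → Y × Y₁) => Θ₃.indicator 1 fun i => (v i (u i), (z i).1, u i))
          fun u z => hf₃ _ _
      · simp [Finset.card_erase_of_mem]
  have hM : (0 : ℝ) < M := by
    have : 0 < M := Fin.pos (Classical.arbitrary (Fin M))
    exact_mod_cast this
  have hexp : ∑ c : (Fin M₁ → Fin n → U) × (Fin M₂ → Fin n → U → X),
      (codebookWeight pU c.1 * codebookWeight pV c.2) *
        ch.err q (superpositionCode e bin Θ₁ Θ₂ Θ₃ c.1 c.2) =
      (1 / (M : ℝ)) * ∑ m : Fin M, ∑ ξ : (Fin M₁ → Fin n → U) × (Fin M₂ → Fin n → U → X) ×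
      (Fin n → Y × Y₁), ensembleWeight pU pV k (e m).1 (e m).2 ξ *
        (if (superpositionCode e bin Θ₁ Θ₂ Θ₃ ξ.1 ξ.2.1).dec (fun i => (ξ.2.2 i).1)
          ((superpositionCode e bin Θ₁ Θ₂ Θ₃ ξ.1 ξ.2.1).relay fun i => (ξ.2.2 i).2) ≠ m
          then 1 else 0) := by
    have hsplit : ∀ G : (Fin M₁ → Fin n → U) × (Fin M₂ → Fin n → U → X) ×
        (Fin n → Y × Y₁) → ℝ, ∑ ξ, G ξ = ∑ c : (Fin M₁ → Fin n → U) × (Fin M₂ → Fin n → U → X),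
          ∑ z, G (c.1, c.2, z) := by
      intro G
      rw [Fintype.sum_prod_type, Fintype.sum_prod_type]
      exact Finset.sum_congr rfl fun _ _ => by rw [Fintype.sum_prod_type]
    simp only [hsplit, err_eq, Finset.mul_sum]
    rw [Finset.sum_comm]
    refine Finset.sum_congr rfl fun m _ => Finset.sum_congr rfl fun c _ =>
      Finset.sum_congr rfl fun z _ => ?_
    simp only [ensembleWeight, hkdef]
    have henc : (superpositionCode e bin Θ₁ Θ₂ Θ₃ c.1 c.2).enc m =
      fun i => c.2 (e m).2 i (c.1 (e m).1 i) := rfl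
    rw [henc]
    ring
  rw [hexp]
  calc _ ≤ (1 / (M : ℝ)) * ∑ _m : Fin M, B :=
        mul_le_mul_of_nonneg_left (Finset.sum_le_sum fun m _ => hmsg m) (by positivity)
    _ = B := by
        simp
        field_simp

end PrimitiveRelayChannel

/-! ### Achievability of the partial decode-forward rate -/

/-- Any pmf on `U × X` arises from its first marginal and an independent random map `U → X`. -/
lemma exists_strategy {U X : Type*} [Fintype U] [Fintype X] [DecidableEq U] [Nonempty X]
    {p : U × X → ℝ} (hp : p ∈ stdSimplex ℝ (U × X)) :
    ∃ pV ∈ stdSimplex ℝ (U → X),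
      ∀ u x, law pV (fun v => v u) x * ∑ x', p (u, x') = p (u, x) := by
  classical
  set cond : U → X → ℝ := fun u =>
    -- where the conditional pmf is undefined, any pmf will do
    if ∑ x', p (u, x') = 0 then Pi.single (Classical.arbitrary X) 1
    else fun x => p (u, x) / ∑ x', p (u, x') with hcond
  have hsum : ∀ u, 0 ≤ ∑ x', p (u, x') := fun u => Finset.sum_nonneg fun x _ => hp.1 _
  have hc : ∀ u, cond u ∈ stdSimplex ℝ X := by
    intro u
    by_cases h : ∑ x', p (u, x') = 0
    · simp only [hcond, h, if_true]
      exact single_mem_stdSimplex ℝ _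
    · simp only [hcond, h, if_false]
      refine ⟨fun x => div_nonneg (hp.1 _) (hsum u), ?_⟩
      rw [← Finset.sum_div, div_self h]
  refine ⟨fun v => ∏ u, cond u (v u), prod_mem_stdSimplex hc, fun u x => ?_⟩
  have h1 : law (fun v : U → X => ∏ u, cond u (v u)) (fun v => v u) x = cond u x := by
    have := sum_prod_mul_apply (w := cond) (fun u => (hc u).2) u fun x' => if x' = x then 1 else 0
    simpa [law] using this
  rw [h1]
  by_cases h : ∑ x', p (u, x') = 0
  · have := (Finset.sum_eq_zero_iff_of_nonneg fun x _ => hp.1 (u, x)).1 h x (Finset.mem_univ x)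
    rw [h, this, mul_zero]
  · simp only [hcond, h, if_false]
    exact div_mul_cancel₀ _ h

section LawLemmas

variable {A B C D E : Type*} [Fintype A]

lemma law_id (p : A → ℝ) (a : A) : law p (fun a => a) a = p a := by
  classical
  simp [law]

lemma law_swap (p : A → ℝ) (f : A → B) (g : A → C) (b : B) (c : C) :
    law p (fun a => (f a, g a)) (b, c) = law p (fun a => (g a, f a)) (c, b) := by
  classical
  simp [law, and_comm]

lemma mutualInfo_law [Fintype B] [Fintype C] [Fintype E] (p : A → ℝ) (t : A → E) (f : E → B)
    (g : E → C) :
    mutualInfo (law p t) f g = mutualInfo p (fun a => f (t a)) (fun a => g (t a)) := by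
  simp only [mutualInfo, law_law]

lemma condMutualInfo_law [Fintype B] [Fintype C] [Fintype D] [Fintype E] (p : A → ℝ)
    (t : A → E) (f : E → B) (g : E → C) (h : E → D) :
    condMutualInfo (law p t) f g h =
      condMutualInfo p (fun a => f (t a)) (fun a => g (t a)) (fun a => h (t a)) := by
  simp only [condMutualInfo, law_law]

end LawLemmas

/-- A member of a residue class modulo `L` has at most `(M - 1) / L` competitors below `M` in its
class, hence none if `M ≤ L`. -/
lemma card_mod_class_le {M L : ℕ} (hL : 0 < L) (a : Fin M) :
    ((Finset.univ.erase a).filter fun a' : Fin M =>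
      (⟨a' % L, Nat.mod_lt _ hL⟩ : Fin L) = ⟨a % L, Nat.mod_lt _ hL⟩).card ≤ (M - 1) / L := by
  classical
  have h1 : (Finset.univ.filter fun a' : Fin M => (a' : ℕ) % L = a % L).card ≤
      (Finset.range ((M - 1) / L + 1)).card := by
    refine Finset.card_le_card_of_injOn (fun a' => (a' : ℕ) / L) (fun a' _ => ?_) ?_
    · have h2 : (a' : ℕ) ≤ M - 1 := by omega
      simpa using Nat.lt_succ_of_le (Nat.div_le_div_right (c := L) h2)
    · intro x hx y hy hxy
      have hx' : (x : ℕ) % L = a % L := by simpa using hx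
      have hy' : (y : ℕ) % L = a % L := by simpa using hy
      dsimp only at hxy
      apply Fin.ext
      rw [← Nat.div_add_mod (x : ℕ) L, ← Nat.div_add_mod (y : ℕ) L, hxy, hx', hy']
  have h2 : (Finset.univ.erase a).filter (fun a' : Fin M =>
      (⟨a' % L, Nat.mod_lt _ hL⟩ : Fin L) = ⟨a % L, Nat.mod_lt _ hL⟩) =
      (Finset.univ.filter fun a' : Fin M => (a' : ℕ) % L = a % L).erase a := by
    ext a'
    simp [Fin.ext_iff, and_comm]
  rw [h2, Finset.card_erase_of_mem (by simp)]
  rw [Finset.card_range] at h1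
  exact Nat.sub_le_iff_le_add.2 h1

namespace PrimitiveRelayChannel

lemma numMessages_sub_one_le (n : ℕ) (R : ℝ) :
    ((numMessages n R - 1 : ℕ) : ℝ) ≤ Real.exp (R * Real.log 2 * n) := by
  have h1 : (2 : ℝ) ^ ((n : ℝ) * R) = Real.exp (R * Real.log 2 * n) := by
    rw [Real.rpow_def_of_pos two_pos]
    congr 1
    ring
  rw [Nat.cast_pred (numMessages_pos n R), ← h1]
  have := Nat.ceil_lt_add_one (a := (2 : ℝ) ^ ((n : ℝ) * R)) (by positivity)
  rw [numMessages]
  linarith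

lemma numMessages_add_le (n : ℕ) (R' R'' : ℝ) :
    numMessages n (R' + R'') ≤ numMessages n R' * numMessages n R'' := by
  refine Nat.ceil_le.2 ?_
  rw [mul_add, Real.rpow_add two_pos, Nat.cast_mul]
  exact mul_le_mul (Nat.le_ceil _) (Nat.le_ceil _) (by positivity) (by positivity)

lemma exp_le_two_mul_numIndices {X S Y Y₁ : Type*} [Fintype Y] [Fintype Y₁]
    (ch : PrimitiveRelayChannel X S Y Y₁) (n : ℕ) :
    Real.exp (ch.C₁ * Real.log 2 * n) ≤ 2 * numIndices n ch.C₁ := by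
  have h1 : (2 : ℝ) ^ ((n : ℝ) * ch.C₁) = Real.exp (ch.C₁ * Real.log 2 * n) := by
    rw [Real.rpow_def_of_pos two_pos]
    congr 1
    ring
  rw [← h1]
  have h2 := Nat.lt_floor_add_one ((2 : ℝ) ^ ((n : ℝ) * ch.C₁))
  have h3 : (1 : ℝ) ≤ numIndices n ch.C₁ := by exact_mod_cast ch.numIndices_pos n
  rw [numIndices] at *
  linarith

section Strategy

variable {X S Y Y₁ U : Type*} [Fintype Y] [Fintype Y₁] (ch : PrimitiveRelayChannel X S Y Y₁)
  [Fintype X] [Fintype U] [DecidableEq U] {pV : (U → X) → ℝ} {p : U × X → ℝ}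

lemma law_strategyLaw (hpV : ∀ u x, law pV (fun v => v u) x * ∑ x', p (u, x') = p (u, x)) (s : S)
    (u : U) (x : X) (z : Y × Y₁) :
    law (ch.strategyLaw (fun u => ∑ x', p (u, x')) pV s)
      (fun ω => ((ω.1, ω.2.1 ω.1), ω.2.2)) ((u, x), z) = p (u, x) * ch.W x s z := by
  classical
  simp only [law, strategyLaw, Fintype.sum_prod_type, Prod.mk.injEq]
  rw [Finset.sum_eq_single u]
  rotate_left
  · intro u' _ hu'
    simp [hu']
  · simp
  have h1 : ∀ v : U → X, ∑ y, ∑ y₁, (if (u = u ∧ v u = x) ∧ (y, y₁) = z then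
      (∑ x', p (u, x')) * (pV v * ch.W (v u) s (y, y₁)) else 0) =
      (if v u = x then pV v else 0) * ((∑ x', p (u, x')) * ch.W x s z) := by
    intro v
    rw [← Fintype.sum_prod_type' (f := fun y y₁ => if (u = u ∧ v u = x) ∧ (y, y₁) = z then
      (∑ x', p (u, x')) * (pV v * ch.W (v u) s (y, y₁)) else 0), Finset.sum_eq_single z]
    · by_cases hv : v u = x
      · simp [hv]
        ring
      · simp [hv]
    · intro z' _ hz'
      simp [hz']
    · simp
  have h2 : ∀ (y : Y) (y₁ : Y₁), ((y, y₁) = z) = (y = z.1 ∧ y₁ = z.2) := fun y y₁ => by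
    rw [Prod.ext_iff]
  simp only [h2] at h1
  obtain ⟨z1, z2⟩ := z
  simp only [Prod.mk.injEq]
  rw [Finset.sum_congr rfl fun v _ => h1 v, ← Finset.sum_mul, ← hpV u x, ← mul_assoc]
  rfl

lemma law_strategyLaw_input
    (hpV : ∀ u x, law pV (fun v => v u) x * ∑ x', p (u, x') = p (u, x)) (s : S) (u : U) (x : X) :
    law (ch.strategyLaw (fun u => ∑ x', p (u, x')) pV s) (fun ω => (ω.1, ω.2.1 ω.1)) (u, x) =
      p (u, x) := by
  rw [← sum_law_pair_right _ (fun ω : U × (U → X) × (Y × Y₁) => (ω.1, ω.2.1 ω.1))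
    fun ω => ω.2.2]
  simp only [ch.law_strategyLaw hpV, ← Finset.mul_sum, (ch.W_mem x s).2, mul_one]

lemma law_strategyLaw_fst
    (hpV : ∀ u x, law pV (fun v => v u) x * ∑ x', p (u, x') = p (u, x)) (s : S) (u : U) :
    law (ch.strategyLaw (fun u => ∑ x', p (u, x')) pV s) (fun ω => ω.1) u = ∑ x', p (u, x') := by
  rw [← sum_law_pair_right _ (fun ω : U × (U → X) × (Y × Y₁) => ω.1) fun ω => ω.2.1 ω.1]
  simp only [ch.law_strategyLaw_input hpV]

variable [Fintype S]

lemma law_mix_strategyLaw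
    (hpV : ∀ u x, law pV (fun v => v u) x * ∑ x', p (u, x') = p (u, x)) (q : S → ℝ) :
    law (mix (ch.strategyLaw (fun u => ∑ x', p (u, x')) pV) q)
      (fun ω => ((ω.1, ω.2.1 ω.1), ω.2.2)) = ch.joint q p := by
  funext ⟨⟨u, x⟩, z⟩
  rw [law_mix]
  simp only [ch.law_strategyLaw hpV, joint, Finset.mul_sum]
  exact Finset.sum_congr rfl fun s _ => by ring

end Strategy

variable {X S Y Y₁ : Type*} [Fintype S] [Fintype Y] [Fintype Y₁]
  (ch : PrimitiveRelayChannel X S Y Y₁)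

lemma joint_mem [Fintype X] {U : Type*} [Fintype U] {q : S → ℝ} (hq : q ∈ stdSimplex ℝ S)
    {p : U × X → ℝ} (hp : p ∈ stdSimplex ℝ (U × X)) :
    ch.joint q p ∈ stdSimplex ℝ ((U × X) × (Y × Y₁)) := by
  refine ⟨fun a => mul_nonneg (hp.1 _) ((ch.avgW_mem hq a.1.2).1 a.2), ?_⟩
  rw [Fintype.sum_prod_type]
  have := fun x => (ch.avgW_mem hq x).2
  simp only [avgW] at this
  simp only [joint, ← Finset.mul_sum, this, mul_one, hp.2]

/-- Derandomization over the whole family: the error probabilities at the members of a dominating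
family control all others, and there are only polynomially many of them. -/
lemma exists_forall_err_le {Q : Set (S → ℝ)} (hQ : Q ⊆ stdSimplex ℝ S) (hQne : Q.Nonempty)
    {n M L : ℕ} {Γ : Type*} [Fintype Γ] {w : Γ → ℝ} (hw : w ∈ stdSimplex ℝ Γ)
    (code : Γ → RelayCode X Y Y₁ n M L) {β : ℝ}
    (h : ∀ q ∈ Q, ∑ γ, w γ * ch.err q (code γ) ≤ β) :
    ∃ γ, ∀ q ∈ Q, ch.err q (code γ) ≤ 2 * ((n + 1) ^ Fintype.card S * β) := by
  classical
  obtain ⟨F, hFQ, hF⟩ := exists_dominating_family hQ hQne n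
  obtain ⟨γ, hγ⟩ := exists_le_of_sum_mul_le (F := fun γ => ∑ T, ch.err (F T) (code γ)) hw.1 hw.2
    (β := (n + 1) ^ Fintype.card S * β) (by
      simp only [Finset.mul_sum]
      rw [Finset.sum_comm]
      refine (Finset.sum_le_sum fun T _ => h _ (hFQ T)).trans (le_of_eq ?_)
      simp)
  refine ⟨γ, fun q hq => le_trans ?_ (mul_le_mul_of_nonneg_left hγ zero_le_two)⟩
  simp only [err]
  rw [Finset.sum_comm, Finset.mul_sum]
  refine Finset.sum_le_sum fun s _ => ?_
  rw [← Finset.sum_mul, ← mul_assoc]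
  exact mul_le_mul_of_nonneg_right (hF q hq s) (ch.errGiven_nonneg _ s)

/-- Rates below the value of some `p(u, x)` are achieved with exponentially small error. -/
theorem exists_code_of_lt_valueDF [Fintype X] [Nonempty X] {Q : Set (S → ℝ)}
    (hQ : Q ⊆ stdSimplex ℝ S) (hQne : Q.Nonempty) {k : ℕ} {p : Fin k × X → ℝ}
    (hp : p ∈ stdSimplex ℝ (Fin k × X)) {R : ℝ} (hR : R < ch.valueDF Q p) :
    ∃ a : ℝ, 0 < a ∧ ∃ N : ℕ, ∀ n ≥ N, ch.HasCode Q R n (Real.exp (-(a * n))) := by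
  classical
  obtain ⟨pV, hV, hpV⟩ := exists_strategy hp
  set pU : Fin k → ℝ := fun u => ∑ x', p (u, x') with hpU
  have hU : pU ∈ stdSimplex ℝ (Fin k) :=
    ⟨fun u => Finset.sum_nonneg fun x _ => hp.1 _, by rw [← hp.2, Fintype.sum_prod_type]⟩
  set κ := ch.strategyLaw pU pV with hκdef
  have hκ := ch.strategyLaw_mem hU hV
  have hlaw := ch.law_mix_strategyLaw (p := p) hpV
  have hJ : ∀ q ∈ Q, ch.joint q p ∈ stdSimplex ℝ _ := fun q hq => ch.joint_mem (hQ hq) hp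
  have hm : ∀ q ∈ Q, mix κ q ∈ stdSimplex ℝ _ := fun q hq => mix_mem hκ (hQ hq)
  -- the three single-letter quantities and the corresponding tests
  set I₁ := ⨅ q : Q, mutualInfo (ch.joint q p) (fun a => a.1.1) (fun a => a.2.2) with hI₁
  set I₂ := ⨅ q : Q, mutualInfo (ch.joint q p) (fun a => a.1.1) (fun a => a.2.1) with hI₂
  set I₃ := ⨅ q : Q, condMutualInfo (ch.joint q p) (fun a => a.1.2) (fun a => a.2.1)
    (fun a => a.1.1) with hI₃
  have hle₁ : ∀ q ∈ Q, I₁ ≤ condMutualInfo (mix κ q) (fun ω => ω.1) (fun ω => ω.2.2.2)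
      (fun _ => ()) := by
    intro q hq
    rw [← mutualInfo_eq_condMutualInfo (hm q hq).2]
    refine (ciInf_le ⟨0, ?_⟩ (⟨q, hq⟩ : Q)).trans (le_of_eq ?_)
    · rintro _ ⟨q', rfl⟩
      exact mutualInfo_nonneg (hJ q' q'.2) _ _
    · rw [← hlaw q, mutualInfo_law]
  have hle₂ : ∀ q ∈ Q, I₂ ≤ condMutualInfo (mix κ q) (fun ω => ω.1) (fun ω => ω.2.2.1)
      (fun _ => ()) := by
    intro q hq
    rw [← mutualInfo_eq_condMutualInfo (hm q hq).2]
    refine (ciInf_le ⟨0, ?_⟩ (⟨q, hq⟩ : Q)).trans (le_of_eq ?_)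
    · rintro _ ⟨q', rfl⟩
      exact mutualInfo_nonneg (hJ q' q'.2) _ _
    · rw [← hlaw q, mutualInfo_law]
  have hle₃ : ∀ q ∈ Q, I₃ ≤ condMutualInfo (mix κ q) (fun ω => ω.2.1 ω.1) (fun ω => ω.2.2.1)
      (fun ω => ω.1) := by
    intro q hq
    refine (ciInf_le ⟨0, ?_⟩ (⟨q, hq⟩ : Q)).trans (le_of_eq ?_)
    · rintro _ ⟨q', rfl⟩
      exact condMutualInfo_nonneg (hJ q' q'.2).1 _ _ _
    · rw [← hlaw q, condMutualInfo_law]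
  have hl2 : 0 < Real.log 2 := Real.log_pos one_lt_two
  -- half of the slack, shared by the two component rates
  set δ := (min (I₂ + ch.C₁) I₁ + I₃ - R) / 2 with hδ
  have hδ0 : 0 < δ := by
    have h1 : R < min (I₂ + ch.C₁) I₁ + I₃ := by
      refine hR.trans_le (le_of_eq ?_)
      rw [valueDF, ← min_add_add_right]
      congr 1
      ring
    simp only [hδ]
    linarith
  obtain ⟨a₁, ha₁, N₁, hN₁⟩ := exists_conditional_test.{0} hκ hQ hQne (fun ω => ω.1)
    (fun ω => ω.2.2.2) (fun _ => ()) (fun x => pU x.1)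
    (fun s => by
      funext ⟨u, _⟩
      rw [law_pair_unit, ch.law_strategyLaw_fst hpV])
    hle₁ (τ := (I₁ - δ / 2) * Real.log 2) (mul_lt_mul_of_pos_right (by linarith) hl2)
  obtain ⟨a₂, ha₂, N₂, hN₂⟩ := exists_conditional_test.{0} hκ hQ hQne (fun ω => ω.1)
    (fun ω => ω.2.2.1) (fun _ => ()) (fun x => pU x.1)
    (fun s => by
      funext ⟨u, _⟩
      rw [law_pair_unit, ch.law_strategyLaw_fst hpV])
    hle₂ (τ := (I₂ - δ / 2) * Real.log 2) (mul_lt_mul_of_pos_right (by linarith) hl2)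
  obtain ⟨a₃, ha₃, N₃, hN₃⟩ := exists_conditional_test hκ hQ hQne (fun ω => ω.2.1 ω.1)
    (fun ω => ω.2.2.1) (fun ω => ω.1) (fun x => p (x.2, x.1))
    (fun s => by
      funext ⟨x, u⟩
      rw [law_swap, ch.law_strategyLaw_input hpV])
    hle₃ (τ := (I₃ - δ / 2) * Real.log 2) (mul_lt_mul_of_pos_right (by linarith) hl2)
  set c := min (min a₁ a₂) (min a₃ (δ / 2 * Real.log 2)) with hc
  have hc0 : 0 < c := by positivity
  have hc₁ : c ≤ a₁ := (min_le_left _ _).trans (min_le_left _ _)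
  have hc₂ : c ≤ a₂ := (min_le_left _ _).trans (min_le_right _ _)
  have hc₃ : c ≤ a₃ := (min_le_right _ _).trans (min_le_left _ _)
  have hc₄ : c ≤ δ / 2 * Real.log 2 := (min_le_right _ _).trans (min_le_right _ _)
  obtain ⟨N₄, hN₄⟩ := eventually_mul_pow_mul_exp_le 14 (Fintype.card S)
    (show c / 2 < c by linarith)
  refine ⟨c / 2, by positivity, max (max N₁ N₂) (max N₃ N₄), fun n hn => ?_⟩
  obtain ⟨Θ₁, hm₁, hf₁⟩ := hN₁ n (((le_max_left _ _).trans (le_max_left _ _)).trans hn)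
  obtain ⟨Θ₂, hm₂, hf₂⟩ := hN₂ n (((le_max_right _ _).trans (le_max_left _ _)).trans hn)
  obtain ⟨Θ₃, hm₃, hf₃⟩ := hN₃ n (((le_max_left _ _).trans (le_max_right _ _)).trans hn)
  have hN₄' := hN₄ n (((le_max_right _ _).trans (le_max_right _ _)).trans hn)
  -- The rates `R'` and `R''` may be negative: then there is a single word, and the error bound only
  -- involves the number of competing words, which is at most `2 ^ (n R')` resp. `2 ^ (n R'')`.
  set R' := min (I₂ + ch.C₁) I₁ - δ with hR'
  set R'' := I₃ - δ with hR''
  have hRR : R = R' + R'' := by simp only [hR', hR'', hδ]; ring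
  set M₁ := numMessages n R' with hM₁
  set M₂ := numMessages n R'' with hM₂
  set L := numIndices n ch.C₁ with hLdef
  have hL : 0 < L := ch.numIndices_pos n
  have hne : Nonempty (Fin (numMessages n R)) := ⟨⟨0, numMessages_pos n R⟩⟩
  have hne₁ : Nonempty (Fin M₁) := ⟨⟨0, numMessages_pos n R'⟩⟩
  have hne₂ : Nonempty (Fin M₂) := ⟨⟨0, numMessages_pos n R''⟩⟩
  obtain ⟨e⟩ : Nonempty (Fin (numMessages n R) ↪ Fin M₁ × Fin M₂) :=
    Function.Embedding.nonempty_of_card_le (by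
      simpa [hM₁, hM₂, hRR] using numMessages_add_le n R' R'')
  set bin : Fin M₁ → Fin L := fun a => ⟨a % L, Nat.mod_lt _ hL⟩ with hbin
  have hexp := fun q (hq : q ∈ Q) => ch.sum_codebookWeight_mul_err_le (hQ hq) hU hV e.injective bin
    (card_mod_class_le hL) Θ₁ Θ₂ Θ₃ (Real.exp_pos _).le (hm₁ q hq) (hm₂ q hq) (hm₃ q hq)
    (fun y₁ => hf₁ pU hU.1 (fun _ u => u) (fun _ u => by rw [law_id, hU.2, mul_one]) y₁
      fun _ => ())
    (fun y => hf₂ pU hU.1 (fun _ u => u) (fun _ u => by rw [law_id, hU.2, mul_one]) y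
      fun _ => ())
    (fun u y => hf₃ pV hV.1 (fun u v => v u) (fun u x => hpV u x) y u)
  have hmono : ∀ {a b : ℝ}, a ≤ b → Real.exp (-(b * n)) ≤ Real.exp (-(a * n)) := fun h =>
    Real.exp_le_exp.2 (neg_le_neg (mul_le_mul_of_nonneg_right h n.cast_nonneg))
  have hb₁ : ((M₁ - 1 : ℕ) : ℝ) * Real.exp (-((I₁ - δ / 2) * Real.log 2 * n)) ≤
      Real.exp (-(c * n)) := by
    refine (mul_le_mul_of_nonneg_right (numMessages_sub_one_le n R')
      (Real.exp_pos _).le).trans ?_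
    rw [← Real.exp_add]
    refine le_trans (Real.exp_le_exp.2 ?_) (hmono hc₄)
    have h1 : R' ≤ I₁ - δ := sub_le_sub_right (min_le_right _ _) δ
    have h2 := mul_le_mul_of_nonneg_right h1 (mul_nonneg hl2.le (n.cast_nonneg (α := ℝ)))
    linarith
  have hb₃ : ((M₂ - 1 : ℕ) : ℝ) * Real.exp (-((I₃ - δ / 2) * Real.log 2 * n)) ≤
      Real.exp (-(c * n)) := by
    refine (mul_le_mul_of_nonneg_right (numMessages_sub_one_le n R'')
      (Real.exp_pos _).le).trans ?_
    rw [← Real.exp_add]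
    refine le_trans (Real.exp_le_exp.2 (le_of_eq ?_)) (hmono hc₄)
    simp only [hR'']
    ring
  have hb₂ : (((M₁ - 1) / L : ℕ) : ℝ) * Real.exp (-((I₂ - δ / 2) * Real.log 2 * n)) ≤
      2 * Real.exp (-(c * n)) := by
    have hLr : (0 : ℝ) < L := by exact_mod_cast hL
    have h1 : (((M₁ - 1) / L : ℕ) : ℝ) ≤
        2 * Real.exp (R' * Real.log 2 * n - ch.C₁ * Real.log 2 * n) := by
      refine Nat.cast_div_le.trans ?_
      rw [div_le_iff₀ hLr, Real.exp_sub]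
      refine (numMessages_sub_one_le n R').trans ?_
      have h2 := ch.exp_le_two_mul_numIndices n
      have h3 := mul_le_mul_of_nonneg_left h2 (Real.exp_pos (R' * Real.log 2 * n)).le
      calc Real.exp (R' * Real.log 2 * n)
          = Real.exp (R' * Real.log 2 * n) * Real.exp (ch.C₁ * Real.log 2 * n) /
              Real.exp (ch.C₁ * Real.log 2 * n) :=
            (mul_div_cancel_right₀ _ (Real.exp_pos _).ne').symm
        _ ≤ Real.exp (R' * Real.log 2 * n) * (2 * L) / Real.exp (ch.C₁ * Real.log 2 * n) :=
            div_le_div_of_nonneg_right h3 (Real.exp_pos _).le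
        _ = _ := by ring
    refine (mul_le_mul_of_nonneg_right h1 (Real.exp_pos _).le).trans ?_
    rw [mul_assoc, ← Real.exp_add]
    refine mul_le_mul_of_nonneg_left (le_trans (Real.exp_le_exp.2 ?_) (hmono hc₄)) zero_le_two
    have h4 : R' ≤ I₂ + ch.C₁ - δ := sub_le_sub_right (min_le_left _ _) δ
    have h5 := mul_le_mul_of_nonneg_right h4 (mul_nonneg hl2.le (n.cast_nonneg (α := ℝ)))
    linarith
  have hw : (fun c : (Fin M₁ → Fin n → Fin k) × (Fin M₂ → Fin n → Fin k → X) =>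
      codebookWeight pU c.1 * codebookWeight pV c.2) ∈ stdSimplex ℝ _ := by
    refine ⟨fun c => mul_nonneg ((codebookWeight_mem hU).1 _) ((codebookWeight_mem hV).1 _), ?_⟩
    rw [Fintype.sum_prod_type]
    simp only [← Finset.mul_sum, (codebookWeight_mem hV).2, mul_one, (codebookWeight_mem hU).2]
  obtain ⟨γ, hγ⟩ := ch.exists_forall_err_le hQ hQne hw
    (fun c => superpositionCode e bin Θ₁ Θ₂ Θ₃ c.1 c.2) (β := 7 * Real.exp (-(c * n)))
    fun q hq => (hexp q hq).trans (by linarith [hmono hc₁, hmono hc₂, hmono hc₃])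
  refine ⟨_, fun q hq => (hγ q hq).trans (le_trans (le_of_eq ?_) hN₄')⟩
  ring

theorem exists_code_of_lt_rateDF [Fintype X] [Nonempty X] {Q : Set (S → ℝ)}
    (hQ : Q ⊆ stdSimplex ℝ S) (hQne : Q.Nonempty) {R : ℝ} (hR : R < ch.rateDF Q) :
    ∃ a : ℝ, 0 < a ∧ ∃ N : ℕ, ∀ n ≥ N, ch.HasCode Q R n (Real.exp (-(a * n))) := by
  classical
  have hne : {r : ℝ | ∃ (k : ℕ) (p : Fin k × X → ℝ), p ∈ stdSimplex ℝ (Fin k × X) ∧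
      r = ch.valueDF Q p}.Nonempty :=
    ⟨_, 1, Pi.single (0, Classical.arbitrary X) 1, single_mem_stdSimplex ℝ _, rfl⟩
  obtain ⟨_, ⟨k, p, hp, rfl⟩, hlt⟩ := exists_lt_of_lt_csSup hne hR
  exact ch.exists_code_of_lt_valueDF hQ hQne hp hlt

lemma achievable_of_lt_rateDF [Fintype X] [Nonempty X] {Q : Set (S → ℝ)}
    (hQ : Q ⊆ stdSimplex ℝ S) (hQne : Q.Nonempty) {R : ℝ} (hR : R < ch.rateDF Q) :
    ch.Achievable Q R := by
  intro ε hε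
  obtain ⟨a, ha, N, hN⟩ := ch.exists_code_of_lt_rateDF hQ hQne hR
  have hlim : Filter.Tendsto (fun n : ℕ => Real.exp (-(a * n))) Filter.atTop (nhds 0) :=
    Real.tendsto_exp_neg_atTop_nhds_zero.comp
      (tendsto_natCast_atTop_atTop.const_mul_atTop ha)
  obtain ⟨N', hN'⟩ := Filter.eventually_atTop.1 (hlim.eventually_le_const hε)
  refine ⟨max N N', fun n hn => ?_⟩
  obtain ⟨c, hc⟩ := hN n ((le_max_left _ _).trans hn)
  exact ⟨c, fun q hq => (hc q hq).trans (hN' n ((le_max_right _ _).trans hn))⟩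

end PrimitiveRelayChannel

theorem lemma2 {X S Y Y₁ : Type*} [Fintype X] [Nonempty X] [Fintype S] [Fintype Y] [Fintype Y₁]
    (ch : PrimitiveRelayChannel X S Y Y₁) (Q : Set (S → ℝ))
    (hQ : Q ⊆ stdSimplex ℝ S) (hQne : Q.Nonempty) :
    ((ch.rateDF Q : ℝ) : EReal) ≤ ch.capacity Q ∧
    ch.randomCapacity Q ≤ ((ch.rateCS Q : ℝ) : EReal) ∧
    ∀ R : ℝ, R < ch.rateDF Q →
      ∃ a : ℝ, 0 < a ∧ ∃ N : ℕ, ∀ n ≥ N, ch.HasCode Q R n (Real.exp (-(a * n))) := by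
  refine ⟨?_, ch.randomCapacity_le_rateCS hQ hQne, fun R hR =>
    ch.exists_code_of_lt_rateDF hQ hQne hR⟩
  refine EReal.ge_of_forall_gt_iff_ge.1 fun R hR => ?_
  exact le_sSup (Set.mem_image_of_mem _
    (ch.achievable_of_lt_rateDF hQ hQne (EReal.coe_lt_coe_iff.1 hR)))
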